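/- Let $n$ robots with positions $q_i(t)\in\mathbb R^2$ communicate over a fixed, undirected, connected graph $G$ on $\{1,\dots,n\}$ with neighbour sets $\mathcal N_i$. Let $a_{ij}=a_{ji}$ and $b_{ij}=b_{ji}$ be weights that are positive if $\{i,j\}$ is an edge and zero otherwise. Let $\mathcal V_h\subseteq\{1,\dots,n\}$ be a nonempty set of $m$ accessible robots, $\delta_i=1$ if $i\in\mathcal V_h$ and $\delta_i=0$ otherwise, and $z=\frac1m\sum_{i\in\mathcal V_h}q_i$. Let $q_r\in\mathbb R^2$ be a constant reference, $\sigma>0$, and let $T>0$ be an arbitrary constant delay. For $t\ge 0$ the robots obey $$\frac{d}{dt}(q_i-q_r)=\sum_{j\in\mathcal N_i}a_{ij}\big((r^q_{ij}-q_r)-(q_i-q_r)\big)-\sum_{j\in\mathcal N_i}b_{ij}(r^\xi_{ij}-\xi_i)+\delta_iu_h,\qquad \dot\xi_i=\sum_{j\in\mathcal N_i}b_{ij}\big((r^q_{ij}-q_r)-(q_i-q_r)\big),$$ with $q_i,\xi_i$ continuous and the derivatives understood as right derivatives (the signals $r^q_{ij},r^\xi_{ij}\in\mathbb R^2$ may jump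 at multiples of $T$). With $r_{ij}=(r^q_{ij},r^\xi_{ij})$ and $p_{ij}=\big(a_{ij}(r^q_{ij}-q_i)-b_{ij}(r^\xi_{ij}-\xi_i),\ b_{ij}(r^q_{ij}-q_i)\big)\in\mathbb R^4$, the two ends of every link $\{i,j\}$ are connected through the scattering variables $$s^+_{ij}=\tfrac1{\sqrt{2\sigma}}(-p_{ij}+\sigma r_{ij}),\quad s^-_{ij}=\tfrac1{\sqrt{2\sigma}}(-p_{ij}-\sigma r_{ij}),\quad s^+_{ji}=\tfrac1{\sqrt{2\sigma}}(p_{ji}+\sigma r_{ji}),\quad s^-_{ji}=\tfrac1{\sqrt{2\sigma}}(p_{ji}-\sigma r_{ji})$$ by $s^+_{ji}(t)=s^+_{ij}(t-T)$ and $s^-_{ij}(t)=s^-_{ji}(t-T)$ for $t\ge0$, where all scattering variables are set to zero at negative times. (Exchanging the roles of $i$ and $j$ gives the same relations.) The command $u_h$ is the output of the human decision process $\Phi$ with input $e=q_r-z$: $\dot x=f(x,e)$, $u_h=h(x,e)$, where $f,h$ are continuous and $x$ takes values in a real normed space. Assume that $\Phi$ is input strictly passive, i.e. there are a differentiable storage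 function $S_h\ge0$ of $x$ and $\epsilon>0$ with $\dot S_h=DS_h(x)f(x,e)\le e^{\mathsf T}h(x,e)-\epsilon\|e\|^2$ for all $x,e$. Assume also that the output of $\Phi$ is bounded as long as its input and its stored energy are bounded: for every $R$ there is a $B$ such that $S_h(x)\le R$ and $\|e\|\le R$ imply $\|h(x,e)\|\le B$. Then every solution of this feedback system on $[0,\infty)$ satisfies $\lim_{t\to\infty}\|q_i(t)-q_r\|=0$ for all $i$. -/

import Mathlib

open Filter Topology Set

/-- The plane `ℝ²` with its Euclidean norm and inner product. -/
abbrev Plane : Type := EuclideanSpace ℝ (Fin 2)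

/-- The space `ℝ⁴ = ℝ² × ℝ²` of the stacked vectors `[xᵀ yᵀ]ᵀ`; only its vector space structure
is used. -/
abbrev Stacked : Type := Plane × Plane

/-- The linear map of `ℝ⁴` given by the block matrix `[a I₂, -b I₂; b I₂, 0]`. -/
def couplingMap (a b : ℝ) (v : Stacked) : Stacked :=
  (a • v.1 - b • v.2, b • v.1)

/-- `p = M (r - [qᵀ ξᵀ]ᵀ)`, the variable that a robot with position `q` and controller state `ξ`
exchanges over a link with weights `a`, `b` on which it currently uses `r`. -/
def exchanged (a b : ℝ) (q ξ : Plane) (r : Stacked) : Stacked :=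
  couplingMap a b (r - (q, ξ))

/-- `s⁺` at the first end `(i, j)` of a link (the signal sent from there). -/
noncomputable def sPlusFirst (σ : ℝ) (p r : Stacked) : Stacked :=
  (1 / Real.sqrt (2 * σ)) • (-p + σ • r)

/-- `s⁻` at the first end `(i, j)` of a link (the signal received there). -/
noncomputable def sMinusFirst (σ : ℝ) (p r : Stacked) : Stacked :=
  (1 / Real.sqrt (2 * σ)) • (-p - σ • r)

/-- `s⁺` at the second end `(j, i)` of a link (the signal received there). -/
noncomputable def sPlusSecond (σ : ℝ) (p r : Stacked) : Stacked :=
  (1 / Real.sqrt (2 * σ)) • (p + σ • r)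

/-- `s⁻` at the second end `(j, i)` of a link (the signal sent from there). -/
noncomputable def sMinusSecond (σ : ℝ) (p r : Stacked) : Stacked :=
  (1 / Real.sqrt (2 * σ)) • (p - σ • r)

/-- A channel with constant delay `T`: the output at time `t` is the input at time `t - T`, where
the input is zero at negative times. -/
noncomputable def delayed (T : ℝ) (s : ℝ → Stacked) (t : ℝ) : Stacked :=
  if 0 ≤ t - T then s (t - T) else 0

/-- The average position `z` of the accessible robots. -/
noncomputable def averagePosition {n : ℕ} (Vh : Finset (Fin n)) (q : Fin n → ℝ → Plane) (t : ℝ) :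
    Plane :=
  (1 / (Vh.card : ℝ)) • ∑ i ∈ Vh, q i t

/-- `δ i = 1` if robot `i` is accessible and `δ i = 0` otherwise. -/
def accessIndicator {n : ℕ} (Vh : Finset (Fin n)) (i : Fin n) : ℝ :=
  if i ∈ Vh then 1 else 0

/-- The human decision process `Φ`: a dynamical system `ẋ = f(x, e)`, `u = h(x, e)` with state
space `E`, input `e ∈ ℝ²` and output `u ∈ ℝ²`, where `f` and `h` are continuous. A memoryless
process is the case of a one-point state space. -/
structure HumanProcess (E : Type*) [NormedAddCommGroup E] [NormedSpace ℝ E] where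
  f : E → Plane → E
  h : E → Plane → Plane
  continuous_f : Continuous fun y : E × Plane => f y.1 y.2
  continuous_h : Continuous fun y : E × Plane => h y.1 y.2

namespace HumanProcess

variable {E : Type*} [NormedAddCommGroup E] [NormedSpace ℝ E]

/-- `S` is a storage function that makes `Φ` input strictly passive with constant `ε`: `S` is
nonnegative and `Ṡ ≤ eᵀ u - ε ‖e‖²`, where `Ṡ = DS(x) f(x, e)` is the derivative of `S` along the
trajectories and `u = h(x, e)`. -/
structure IsInputStrictlyPassiveWith (Φ : HumanProcess E) (S : E → ℝ) (ε : ℝ) : Prop where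
  eps_pos : 0 < ε
  nonneg : ∀ x, 0 ≤ S x
  differentiable : Differentiable ℝ S
  dissipation : ∀ x e, fderiv ℝ S x (Φ.f x e) ≤ inner ℝ e (Φ.h x e) - ε * ‖e‖ ^ 2

/-- The output of `Φ` stays bounded as long as its input and its stored energy stay bounded. -/
def HasBoundedOutput (Φ : HumanProcess E) (S : E → ℝ) : Prop :=
  ∀ R : ℝ, ∃ B : ℝ, ∀ x e, S x ≤ R → ‖e‖ ≤ R → ‖Φ.h x e‖ ≤ B

end HumanProcess

/-- A solution on `[0, ∞)` of the feedback system: `q i` are the robot positions, `ξ i` the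
controller states, `r i j = (r^q_ij, r^ξ_ij)` the signals that robot `i` uses in place of
`(q_j, ξ_j)`, `x` the state of the human process and `uh` the human command.

The signals `r i j` jump at the multiples of `T`, because the scattering variables jump at time
zero. Hence the robot equations are required of the right derivative, at every time, of
continuous functions; this is the same as asking for them in integrated form.

The channel relations are stated for both orderings `(i, j)` and `(j, i)` of the ends of a link;
exchanging the two ends turns `sPlus` and `sMinus` into each other up to sign, so the two
orderings say the same and no orientation of the links has to be chosen. -/
structure IsFeedbackSolution {n : ℕ} (G : SimpleGraph (Fin n)) [DecidableRel G.Adj]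
    (a b : Fin n → Fin n → ℝ) (Vh : Finset (Fin n)) (σ T : ℝ) (qr : Plane)
    {E : Type*} [NormedAddCommGroup E] [NormedSpace ℝ E] (Φ : HumanProcess E)
    (q ξ : Fin n → ℝ → Plane) (r : Fin n → Fin n → ℝ → Stacked)
    (x : ℝ → E) (uh : ℝ → Plane) : Prop where
  continuous_q : ∀ i, ContinuousOn (q i) (Ici 0)
  continuous_ξ : ∀ i, ContinuousOn (ξ i) (Ici 0)
  robot : ∀ i, ∀ t, 0 ≤ t →
    HasDerivWithinAt (fun τ => q i τ - qr)
      (∑ j ∈ G.neighborFinset i, a i j • (((r i j t).1 - qr) - (q i t - qr))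
        - ∑ j ∈ G.neighborFinset i, b i j • ((r i j t).2 - ξ i t)
        + accessIndicator Vh i • uh t)
      (Ici t) t
  controller : ∀ i, ∀ t, 0 ≤ t →
    HasDerivWithinAt (ξ i)
      (∑ j ∈ G.neighborFinset i, b i j • (((r i j t).1 - qr) - (q i t - qr)))
      (Ici t) t
  channel_plus : ∀ i j, G.Adj i j → ∀ t, 0 ≤ t →
    sPlusSecond σ (exchanged (a j i) (b j i) (q j t) (ξ j t) (r j i t)) (r j i t) =
      delayed T (fun τ =>
        sPlusFirst σ (exchanged (a i j) (b i j) (q i τ) (ξ i τ) (r i j τ)) (r i j τ)) t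
  channel_minus : ∀ i j, G.Adj i j → ∀ t, 0 ≤ t →
    sMinusFirst σ (exchanged (a i j) (b i j) (q i t) (ξ i t) (r i j t)) (r i j t) =
      delayed T (fun τ =>
        sMinusSecond σ (exchanged (a j i) (b j i) (q j τ) (ξ j τ) (r j i τ)) (r j i τ)) t
  human_state : ∀ t, 0 ≤ t →
    HasDerivWithinAt x (Φ.f (x t) (qr - averagePosition Vh q t)) (Ici 0) t
  human_output : ∀ t, 0 ≤ t → uh t = Φ.h (x t) (qr - averagePosition Vh q t)

/-! Work with positions relative to the reference and with the deviations `d i j`, `g i j` of the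
link signals from the local states `q i`, `ξ i`. The power absorbed at a link end is, up to the
factor `1 / (4σ)`, the squared incoming wave minus the squared outgoing wave. A delay only postpones
waves, so the links release at most a fixed amount of energy. Adding the agents' energy and `m`
times the human storage cancels the power exchanged through `u`. This gives bounded `q`, `ξ`, stored
energy and hence `u`, together with finite integrals of `‖d i j‖ ^ 2` and `‖e‖ ^ 2`
(`exists_energy_bound`, `exists_bounds`).

The signals `d`, `g` jump, so Barbalat's lemma is applied to `q` only. "Small" means that integrals
of the norm over sliding windows vanish (`VanishingMean`), which follows from finite energy. The
derivative of `ξ` is small, so its increments over fixed times tend to zero. The link relations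
express `g` through bounded quantities and small ones, so `q` is uniformly continuous near infinity.
Two such expressions for the same `g` show that `q i (t + 2T) - 2 q j (t + T) + q i t` tends to zero
on each edge. The sequence alternating between the two ends is thus asymptotically affine, and being
bounded it is asymptotically constant: `q j (t + T) - q i t` tends to zero (`tendsto_neighbor`).

This still permits an oscillation of period `2T` with opposite phases at adjacent robots. The
integrated equation over one delay excludes it (`exists_drift`). For a robot without human input,
the increment over `T` is asymptotically `T`-periodic, hence zero by boundedness, and edges carry
this to all robots. If every robot is accessible, the common input cancels in differences between
neighbours, and the same argument applies to them. So neighbours agree at equal times. Connectedness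
gives consensus, and `e → 0` fixes the common limit at the reference. -/

/-! ### Piecewise continuous functions on the half-line -/

/-- `F` agrees on each interval `[kT, (k+1)T)`, `k : ℕ`, with a continuous function. -/
def PiecewiseContinuous {X : Type*} [TopologicalSpace X] (T : ℝ) (F : ℝ → X) : Prop :=
  ∀ k : ℕ, ∃ G : ℝ → X, Continuous G ∧ EqOn F G (Ico (k * T) ((k + 1) * T))

theorem exists_nat_mem_Ico {T : ℝ} (hT : 0 < T) {t : ℝ} (ht : 0 ≤ t) :
    ∃ k : ℕ, t ∈ Ico (k * T) ((k + 1) * T) := by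
  refine ⟨⌊t / T⌋₊, ?_, ?_⟩
  · exact (le_div_iff₀ hT).1 (Nat.floor_le (by positivity))
  · exact (div_lt_iff₀ hT).1 (Nat.lt_floor_add_one _)

namespace PiecewiseContinuous

variable {X Y Z : Type*} [TopologicalSpace X] [TopologicalSpace Y] [TopologicalSpace Z] {T : ℝ}

theorem of_continuousOn (hT : 0 < T) {F : ℝ → X} (hF : ContinuousOn F (Ici 0)) :
    PiecewiseContinuous T F := fun k => by
  refine ⟨fun t => F (max t 0), ?_, fun t ht => ?_⟩
  · exact hF.comp_continuous (by fun_prop) fun t => le_max_right t 0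
  · have : 0 ≤ t := le_trans (by positivity) ht.1
    simp [max_eq_left this]

theorem map {F : ℝ → X} (hF : PiecewiseContinuous T F) {φ : X → Y} (hφ : Continuous φ) :
    PiecewiseContinuous T fun t => φ (F t) := fun k => by
  obtain ⟨G, hG, h⟩ := hF k
  exact ⟨fun t => φ (G t), hφ.comp hG, fun t ht => congrArg φ (h ht)⟩

theorem map₂ {F : ℝ → X} {F' : ℝ → Y} (hF : PiecewiseContinuous T F)
    (hF' : PiecewiseContinuous T F') {φ : X → Y → Z} (hφ : Continuous fun y : X × Y => φ y.1 y.2) :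
    PiecewiseContinuous T fun t => φ (F t) (F' t) := fun k => by
  obtain ⟨G, hG, h⟩ := hF k
  obtain ⟨G', hG', h'⟩ := hF' k
  refine ⟨fun t => φ (G t) (G' t), hφ.comp (hG.prodMk hG'), fun t ht => ?_⟩
  simp only [h ht, h' ht]

theorem sum {ι A : Type*} [TopologicalSpace A] [AddCommMonoid A] [ContinuousAdd A] {s : Finset ι}
    {F : ι → ℝ → A} (hF : ∀ i ∈ s, PiecewiseContinuous T (F i)) :
    PiecewiseContinuous T fun t => ∑ i ∈ s, F i t := fun k => by
  choose! G hG h using fun i hi => hF i hi k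
  refine ⟨fun t => ∑ i ∈ s, G i t, continuous_finsetSum _ hG, fun t ht => ?_⟩
  exact Finset.sum_congr rfl fun i hi => h i hi ht

theorem add {A : Type*} [TopologicalSpace A] [AddCommMonoid A] [ContinuousAdd A]
    {F F' : ℝ → A} (hF : PiecewiseContinuous T F) (hF' : PiecewiseContinuous T F') :
    PiecewiseContinuous T fun t => F t + F' t :=
  hF.map₂ hF' (by fun_prop)

theorem sub {A : Type*} [NormedAddCommGroup A]
    {F F' : ℝ → A} (hF : PiecewiseContinuous T F) (hF' : PiecewiseContinuous T F') :
    PiecewiseContinuous T fun t => F t - F' t :=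
  hF.map₂ hF' (by fun_prop)

theorem const_smul {A : Type*} [NormedAddCommGroup A] [NormedSpace ℝ A]
    {F : ℝ → A} (hF : PiecewiseContinuous T F) (c : ℝ) :
    PiecewiseContinuous T fun t => c • F t :=
  hF.map (by fun_prop)

theorem continuousWithinAt (hT : 0 < T) {F : ℝ → X} (hF : PiecewiseContinuous T F) {t : ℝ}
    (ht : 0 ≤ t) : ContinuousWithinAt F (Ici t) t := by
  obtain ⟨k, hk⟩ := exists_nat_mem_Ico hT ht
  obtain ⟨G, hG, h⟩ := hF k
  refine hG.continuousWithinAt.congr_of_eventuallyEq ?_ (h hk)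
  filter_upwards [Ico_mem_nhdsGE hk.2] with s hs
  exact h ⟨hk.1.trans hs.1, hs.2⟩

theorem intervalIntegrable {A : Type*} [NormedAddCommGroup A] (hT : 0 < T) {F : ℝ → A}
    (hF : PiecewiseContinuous T F) {s t : ℝ} (hs : 0 ≤ s) (ht : 0 ≤ t) :
    IntervalIntegrable F MeasureTheory.volume s t := by
  have key : ∀ t, 0 ≤ t → IntervalIntegrable F MeasureTheory.volume 0 t := by
    intro t ht
    obtain ⟨k, hk⟩ := exists_nat_mem_Ico hT ht
    have hint : IntervalIntegrable F MeasureTheory.volume (((0 : ℕ) : ℝ) * T)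
        (((k + 1 : ℕ) : ℝ) * T) := by
      refine IntervalIntegrable.trans_iterate (a := fun k : ℕ => (k : ℝ) * T) fun l _ => ?_
      obtain ⟨G, hG, h⟩ := hF l
      refine (hG.intervalIntegrable _ _).congr_uIoo fun τ hτ => (h ?_).symm
      have hle : (l : ℝ) * T ≤ ((l + 1 : ℕ) : ℝ) * T := by
        push_cast; nlinarith
      rw [uIoo_of_le hle] at hτ
      push_cast at hτ
      exact ⟨hτ.1.le, hτ.2⟩
    refine hint.mono_set ?_
    have hle : (0 : ℝ) ≤ ((k + 1 : ℕ) : ℝ) * T := by positivity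
    simp only [Nat.cast_zero, zero_mul]
    rw [uIcc_of_le ht, uIcc_of_le hle]
    refine Icc_subset_Icc le_rfl ?_
    push_cast
    exact hk.2.le
  exact (key s hs).symm.trans (key t ht)

theorem hasDerivWithinAt_integral {A : Type*} [NormedAddCommGroup A] [NormedSpace ℝ A]
    [CompleteSpace A] (hT : 0 < T) {F : ℝ → A} (hF : PiecewiseContinuous T F) {t : ℝ}
    (ht : 0 ≤ t) : HasDerivWithinAt (fun u => ∫ τ in (0 : ℝ)..u, F τ) (F t) (Ici t) t := by
  refine intervalIntegral.integral_hasDerivWithinAt_right (t := Ioi t)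
    (hF.intervalIntegrable hT le_rfl ht) ?_
    ((hF.continuousWithinAt hT ht).mono Ioi_subset_Ici_self)
  refine ⟨Ioc t (t + 1), Ioc_mem_nhdsGT (by linarith), ?_⟩
  exact (hF.intervalIntegrable hT ht (by linarith : (0 : ℝ) ≤ t + 1)).1.aestronglyMeasurable

theorem continuousOn_integral {A : Type*} [NormedAddCommGroup A] [NormedSpace ℝ A]
    (hT : 0 < T) {F : ℝ → A} (hF : PiecewiseContinuous T F) {t : ℝ}
    (ht : 0 ≤ t) : ContinuousOn (fun u => ∫ τ in (0 : ℝ)..u, F τ) (Icc 0 t) := by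
  have := intervalIntegral.continuousOn_primitive_interval
    ((intervalIntegrable_iff' (by finiteness)).1 (hF.intervalIntegrable hT le_rfl ht))
  rwa [uIcc_of_le ht] at this

/-- The jumps of `F` do no harm: a continuous function with an integrable right derivative is its
integral. -/
theorem integral_eq_sub {A : Type*} [NormedAddCommGroup A] [NormedSpace ℝ A]
    [CompleteSpace A] (hT : 0 < T) {f F : ℝ → A} (hf : ContinuousOn f (Ici 0))
    (hF : PiecewiseContinuous T F)
    (hderiv : ∀ t, 0 ≤ t → HasDerivWithinAt f (F t) (Ici t) t) {s t : ℝ} (hs : 0 ≤ s)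
    (hst : s ≤ t) : ∫ τ in s..t, F τ = f t - f s := by
  refine intervalIntegral.integral_eq_sub_of_hasDeriv_right_of_le hst
    (hf.mono fun τ hτ => hs.trans hτ.1) (fun τ hτ => ?_)
    (hF.intervalIntegrable hT hs (hs.trans hst))
  exact (hderiv τ (hs.trans hτ.1.le)).mono Ioi_subset_Ici_self

end PiecewiseContinuous

/-! ### Functions whose integral over a sliding window vanishes at infinity -/

section Vanishing

set_option linter.unusedSectionVars false

variable {V : Type*} [NormedAddCommGroup V] [NormedSpace ℝ V]

/-- `F` is locally integrable on `[0, ∞)` and the integral of `‖F‖` over a window of fixed length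
tends to zero as the window moves to infinity. -/
structure VanishingMean (F : ℝ → V) : Prop where
  intervalIntegrable : ∀ ⦃s t : ℝ⦄, 0 ≤ s → 0 ≤ t → IntervalIntegrable F MeasureTheory.volume s t
  tendsto : ∀ ⦃h : ℝ⦄, 0 ≤ h → Tendsto (fun t => ∫ τ in t..t + h, ‖F τ‖) atTop (𝓝 0)

namespace VanishingMean

theorem of_bound {F G : ℝ → V} (hG : VanishingMean G)
    (hF : ∀ ⦃s t : ℝ⦄, 0 ≤ s → 0 ≤ t → IntervalIntegrable F MeasureTheory.volume s t)
    (h : ∀ t, 0 ≤ t → ‖F t‖ ≤ ‖G t‖) : VanishingMean F := by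
  refine ⟨hF, fun l hl => ?_⟩
  refine squeeze_zero' ?_ ?_ (hG.tendsto hl)
  · filter_upwards with t
    exact intervalIntegral.integral_nonneg (by linarith) fun _ _ => norm_nonneg _
  · filter_upwards [eventually_ge_atTop 0] with t ht
    exact intervalIntegral.integral_mono_on (by linarith) (hF ht (by linarith)).norm
      (hG.intervalIntegrable ht (by linarith)).norm fun τ hτ => h τ (ht.trans hτ.1)

theorem congr {F G : ℝ → V} (hG : VanishingMean G) (h : ∀ t, 0 ≤ t → F t = G t) :
    VanishingMean F := by
  refine hG.of_bound (fun s t hs ht => ?_) fun t ht => (congrArg norm (h t ht)).le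
  refine (hG.intervalIntegrable hs ht).congr fun τ hτ => (h τ ?_).symm
  exact le_of_lt (lt_of_le_of_lt (le_min hs ht) hτ.1)

theorem add {F G : ℝ → V} (hF : VanishingMean F) (hG : VanishingMean G) :
    VanishingMean fun t => F t + G t := by
  refine ⟨fun s t hs ht => (hF.intervalIntegrable hs ht).add (hG.intervalIntegrable hs ht),
    fun l hl => ?_⟩
  refine squeeze_zero' ?_ ?_ (by simpa using (hF.tendsto hl).add (hG.tendsto hl))
  · filter_upwards with t
    exact intervalIntegral.integral_nonneg (by linarith) fun _ _ => norm_nonneg _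
  · filter_upwards [eventually_ge_atTop 0] with t ht
    have hf := hF.intervalIntegrable ht (by linarith : (0 : ℝ) ≤ t + l)
    have hg := hG.intervalIntegrable ht (by linarith : (0 : ℝ) ≤ t + l)
    rw [← intervalIntegral.integral_add hf.norm hg.norm]
    exact intervalIntegral.integral_mono_on (by linarith) (hf.add hg).norm (hf.norm.add hg.norm)
      fun τ _ => norm_add_le _ _

theorem const_smul {F : ℝ → V} (hF : VanishingMean F) (c : ℝ) :
    VanishingMean fun t => c • F t := by
  refine ⟨fun s t hs ht => (hF.intervalIntegrable hs ht).smul c, fun l hl => ?_⟩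
  simpa [norm_smul] using (hF.tendsto hl).const_mul ‖c‖

theorem sub {F G : ℝ → V} (hF : VanishingMean F) (hG : VanishingMean G) :
    VanishingMean fun t => F t - G t :=
  (hF.add (hG.const_smul (-1))).congr fun t _ => by simp [sub_eq_add_neg]

theorem zero : VanishingMean fun _ => (0 : V) :=
  ⟨fun _ _ _ _ => by simp, fun _ _ => by simp⟩

theorem sum {ι : Type*} {s : Finset ι} {F : ι → ℝ → V} (hF : ∀ i ∈ s, VanishingMean (F i)) :
    VanishingMean fun t => ∑ i ∈ s, F i t := by
  classical
  induction s using Finset.induction_on with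
  | empty => simpa using zero
  | insert i s hi ih =>
    simp only [Finset.sum_insert hi]
    exact (hF i (Finset.mem_insert_self i s)).add
      (ih fun j hj => hF j (Finset.mem_insert_of_mem hj))

theorem shift {F : ℝ → V} (hF : VanishingMean F) {T : ℝ} (hT : 0 ≤ T) :
    VanishingMean fun t => F (t + T) := by
  refine ⟨fun s t hs ht => ?_, fun l hl => ?_⟩
  · have := (hF.intervalIntegrable (add_nonneg hs hT) (add_nonneg ht hT)).comp_add_right T
    simpa using this
  · refine ((hF.tendsto hl).comp (tendsto_atTop_add_const_right atTop T tendsto_id)).congr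
      fun t => ?_
    simp only [Function.comp, id]
    rw [intervalIntegral.integral_comp_add_right (fun τ => ‖F τ‖)]
    congr 1
    ring

theorem of_tendsto {F : ℝ → V} (hF : ContinuousOn F (Ici 0)) (h : Tendsto F atTop (𝓝 0)) :
    VanishingMean F := by
  have hint : ∀ ⦃s t : ℝ⦄, 0 ≤ s → 0 ≤ t → IntervalIntegrable F MeasureTheory.volume s t :=
    fun s t hs ht => (hF.mono fun τ hτ => (le_min hs ht).trans hτ.1).intervalIntegrable
  refine ⟨hint, fun l hl => ?_⟩
  rw [Metric.tendsto_atTop]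
  intro η hη
  have hη' : 0 < η / (l + 1) := by positivity
  obtain ⟨N, hN⟩ := Metric.tendsto_atTop.1 h _ hη'
  refine ⟨max N 0, fun t ht => ?_⟩
  have ht0 : 0 ≤ t := (le_max_right _ _).trans ht
  have h0 : 0 ≤ ∫ τ in t..t + l, ‖F τ‖ :=
    intervalIntegral.integral_nonneg (by linarith) fun _ _ => norm_nonneg _
  have h1 : ∫ τ in t..t + l, ‖F τ‖ ≤ ∫ τ in t..t + l, η / (l + 1) := by
    refine intervalIntegral.integral_mono_on (by linarith) (hint ht0 (by linarith)).norm
      (by simp) fun τ hτ => ?_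
    have := hN τ (((le_max_left _ _).trans ht).trans hτ.1)
    rw [dist_zero_right] at this
    exact this.le
  rw [Real.dist_eq, sub_zero, abs_of_nonneg h0]
  refine lt_of_le_of_lt h1 ?_
  simp only [intervalIntegral.integral_const, add_sub_cancel_left, smul_eq_mul]
  rw [mul_div_assoc', div_lt_iff₀ (by positivity)]
  nlinarith

/-- A piecewise continuous function with finite energy has vanishing mean. -/
theorem of_energy_le {T : ℝ} (hT : 0 < T) {F : ℝ → V} (hF : PiecewiseContinuous T F) {K : ℝ}
    (hK : ∀ t, 0 ≤ t → ∫ τ in (0 : ℝ)..t, ‖F τ‖ ^ 2 ≤ K) : VanishingMean F := by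
  have hsq : PiecewiseContinuous T fun t => ‖F t‖ ^ 2 :=
    hF.map (φ := fun v => ‖v‖ ^ 2) (by fun_prop)
  refine ⟨fun s t hs ht => hF.intervalIntegrable hT hs ht, fun l hl => ?_⟩
  -- The `max` freezes the energy at negative times, so it is monotone on all of `ℝ`; being bounded
  -- it converges, and its increments vanish.
  set E : ℝ → ℝ := fun t => ∫ τ in (0 : ℝ)..max t 0, ‖F τ‖ ^ 2 with hE
  have hsub : ∀ s t, 0 ≤ s → s ≤ t → ∫ τ in s..t, ‖F τ‖ ^ 2 = E t - E s := by
    intro s t hs hst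
    simp only [hE, max_eq_left hs, max_eq_left (hs.trans hst)]
    rw [intervalIntegral.integral_interval_sub_left]
    · exact hsq.intervalIntegrable hT le_rfl (hs.trans hst)
    · exact hsq.intervalIntegrable hT le_rfl hs
  have hmono : Monotone E := by
    intro s t hst
    have h1 := hsub (max s 0) (max t 0) (le_max_right _ _) (max_le_max_right _ hst)
    have h2 : 0 ≤ ∫ τ in max s 0..max t 0, ‖F τ‖ ^ 2 :=
      intervalIntegral.integral_nonneg (max_le_max_right _ hst) fun _ _ => by positivity
    have h3 : ∀ u, E (max u 0) = E u := fun u => by simp [hE]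
    rw [h1, h3, h3] at h2
    linarith
  have hlim := tendsto_atTop_ciSup hmono ⟨K, by
    rintro _ ⟨t, rfl⟩
    exact hK _ (le_max_right _ _)⟩
  have hdiff : Tendsto (fun t => E (t + l) - E t) atTop (𝓝 0) := by
    simpa using (hlim.comp (tendsto_atTop_add_const_right atTop l tendsto_id)).sub hlim
  rw [Metric.tendsto_atTop]
  intro η hη
  -- Weight in `‖F‖ ≤ c ‖F‖ ^ 2 + 1 / (4c)`: since `η c = l + η`, the constant term integrates to at
  -- most `η / 4` over the window.
  set c : ℝ := l / η + 1 with hc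
  have hcpos : 0 < c := by positivity
  obtain ⟨N, hN⟩ := Metric.tendsto_atTop.1 hdiff (η / (2 * c)) (by positivity)
  refine ⟨max N 0, fun t ht => ?_⟩
  have ht0 : 0 ≤ t := (le_max_right _ _).trans ht
  have hN' := hN t ((le_max_left _ _).trans ht)
  rw [Real.dist_eq, sub_zero] at hN'
  have h0 : 0 ≤ ∫ τ in t..t + l, ‖F τ‖ :=
    intervalIntegral.integral_nonneg (by linarith) fun _ _ => norm_nonneg _
  have hi := hsq.intervalIntegrable hT ht0 (by linarith : 0 ≤ t + l)
  have h1 : ∫ τ in t..t + l, ‖F τ‖ ≤ ∫ τ in t..t + l, (c * ‖F τ‖ ^ 2 + 1 / (4 * c)) := by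
    refine intervalIntegral.integral_mono_on (by linarith)
      (hF.intervalIntegrable hT ht0 (by linarith)).norm
      ((hi.const_mul c).add (by simp)) fun τ _ => ?_
    have : c * ‖F τ‖ ^ 2 + 1 / (4 * c) - ‖F τ‖ = c * (‖F τ‖ - 1 / (2 * c)) ^ 2 := by
      field_simp
      ring
    nlinarith [mul_nonneg hcpos.le (sq_nonneg (‖F τ‖ - 1 / (2 * c)))]
  rw [intervalIntegral.integral_add (hi.const_mul c) (by simp),
    intervalIntegral.integral_const_mul, hsub t (t + l) ht0 (by linarith)] at h1
  simp only [intervalIntegral.integral_const, add_sub_cancel_left, smul_eq_mul] at h1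
  rw [Real.dist_eq, sub_zero, abs_of_nonneg h0]
  have h2 : c * (E (t + l) - E t) < η / 2 := by
    have := (abs_lt.1 hN').2
    rw [lt_div_iff₀ (by positivity)] at this
    linarith
  have h3 : l * (1 / (4 * c)) ≤ η / 4 := by
    rw [mul_one_div, div_le_iff₀ (by positivity)]
    have : η * c = l + η := by rw [hc]; field_simp
    nlinarith
  linarith

end VanishingMean

/-! ### Asymptotic uniform continuity and Barbalat's lemma -/

/-- `f` is uniformly continuous near infinity. -/
def UniformlyContinuousAtInfinity (f : ℝ → V) : Prop :=
  ∀ η > 0, ∃ δ > 0, ∃ N, ∀ t, N ≤ t → ∀ h, 0 ≤ h → h ≤ δ → ‖f (t + h) - f t‖ ≤ η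

namespace UniformlyContinuousAtInfinity

theorem add {f g : ℝ → V} (hf : UniformlyContinuousAtInfinity f)
    (hg : UniformlyContinuousAtInfinity g) :
    UniformlyContinuousAtInfinity fun t => f t + g t := by
  intro η hη
  obtain ⟨δ, hδ, N, h⟩ := hf (η / 2) (by positivity)
  obtain ⟨δ', hδ', N', h'⟩ := hg (η / 2) (by positivity)
  refine ⟨min δ δ', lt_min hδ hδ', max N N', fun t ht l hl hlδ => ?_⟩
  have h1 := h t ((le_max_left _ _).trans ht) l hl (hlδ.trans (min_le_left _ _))
  have h2 := h' t ((le_max_right _ _).trans ht) l hl (hlδ.trans (min_le_right _ _))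
  calc ‖f (t + l) + g (t + l) - (f t + g t)‖
      = ‖(f (t + l) - f t) + (g (t + l) - g t)‖ := by congr 1; abel
    _ ≤ _ := norm_add_le _ _
    _ ≤ η := by linarith

theorem const_smul {f : ℝ → V} (hf : UniformlyContinuousAtInfinity f) (c : ℝ) :
    UniformlyContinuousAtInfinity fun t => c • f t := by
  intro η hη
  obtain ⟨δ, hδ, N, h⟩ := hf (η / (‖c‖ + 1)) (by positivity)
  refine ⟨δ, hδ, N, fun t ht l hl hlδ => ?_⟩
  have h1 := h t ht l hl hlδ
  rw [le_div_iff₀ (by positivity)] at h1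
  rw [← smul_sub, norm_smul]
  nlinarith [norm_nonneg (f (t + l) - f t)]

theorem const (v : V) : UniformlyContinuousAtInfinity fun _ : ℝ => v :=
  fun η hη => ⟨1, one_pos, 0, fun t _ l _ _ => by simpa using hη.le⟩

theorem sub {f g : ℝ → V} (hf : UniformlyContinuousAtInfinity f)
    (hg : UniformlyContinuousAtInfinity g) :
    UniformlyContinuousAtInfinity fun t => f t - g t := by
  simpa [sub_eq_add_neg] using hf.add (hg.const_smul (-1))

theorem sum {ι : Type*} {s : Finset ι} {f : ι → ℝ → V}
    (hf : ∀ i ∈ s, UniformlyContinuousAtInfinity (f i)) :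
    UniformlyContinuousAtInfinity fun t => ∑ i ∈ s, f i t := by
  classical
  induction s using Finset.induction_on with
  | empty => simpa using const 0
  | insert i s hi ih =>
    simp only [Finset.sum_insert hi]
    exact (hf i (Finset.mem_insert_self i s)).add
      (ih fun j hj => hf j (Finset.mem_insert_of_mem hj))

theorem shift {f : ℝ → V} (hf : UniformlyContinuousAtInfinity f) (T : ℝ) :
    UniformlyContinuousAtInfinity fun t => f (t + T) := by
  intro η hη
  obtain ⟨δ, hδ, N, h⟩ := hf η hη
  refine ⟨δ, hδ, N - T, fun t ht l hl hlδ => ?_⟩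
  have := h (t + T) (by linarith) l hl hlδ
  rwa [add_right_comm] at this

/-- A function whose increments are integrals of the sum of a bounded function and one with
vanishing mean. -/
theorem of_integral {f F G : ℝ → V} (hF : VanishingMean F)
    (hG : ∀ ⦃s t : ℝ⦄, 0 ≤ s → 0 ≤ t → IntervalIntegrable G MeasureTheory.volume s t) {B : ℝ}
    (hB : ∀ t, 0 ≤ t → ‖G t‖ ≤ B)
    (hf : ∀ s t, 0 ≤ s → s ≤ t → f t - f s = ∫ τ in s..t, (G τ + F τ)) :
    UniformlyContinuousAtInfinity f := by
  intro η hη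
  have hB0 : 0 ≤ B := (norm_nonneg _).trans (hB 0 le_rfl)
  obtain ⟨N, hN⟩ := Metric.tendsto_atTop.1 (hF.tendsto zero_le_one) (η / 2) (by positivity)
  -- The bound `1` keeps the interval inside the unit window used for `F`; the other bound leaves at
  -- most `η / 2` for the integral of `G`.
  refine ⟨min 1 (η / (2 * (B + 1))), by positivity, max N 0, fun t ht l hl hlδ => ?_⟩
  have ht0 : 0 ≤ t := (le_max_right _ _).trans ht
  have hl1 : l ≤ 1 := hlδ.trans (min_le_left _ _)
  have hl2 := hlδ.trans (min_le_right _ _)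
  rw [le_div_iff₀ (by positivity)] at hl2
  have htl : 0 ≤ t + l := by linarith
  have hFi := hF.intervalIntegrable ht0 htl
  rw [hf t (t + l) ht0 (by linarith), intervalIntegral.integral_add (hG ht0 htl) hFi]
  have h1 : ‖∫ τ in t..t + l, G τ‖ ≤ B * |t + l - t| := by
    refine intervalIntegral.norm_integral_le_of_norm_le_const fun τ hτ => hB τ ?_
    exact le_of_lt (lt_of_le_of_lt (le_min ht0 htl) hτ.1)
  have h2 : ‖∫ τ in t..t + l, F τ‖ ≤ ∫ τ in t..t + l, ‖F τ‖ :=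
    intervalIntegral.norm_integral_le_integral_norm (by linarith)
  have h3 : ∫ τ in t..t + l, ‖F τ‖ ≤ ∫ τ in t..t + 1, ‖F τ‖ := by
    refine intervalIntegral.integral_mono_interval le_rfl (by linarith) (by linarith)
      (Eventually.of_forall fun _ => norm_nonneg _)
      (hF.intervalIntegrable ht0 (by linarith)).norm
  have h4 := hN t ((le_max_left _ _).trans ht)
  rw [Real.dist_eq, sub_zero] at h4
  have h5 := (abs_lt.1 h4).2
  rw [add_sub_cancel_left, abs_of_nonneg hl] at h1
  refine (norm_add_le _ _).trans ?_
  nlinarith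

/-- **Barbalat's lemma**. -/
theorem tendsto_zero {f : ℝ → V} (hf : UniformlyContinuousAtInfinity f)
    (hv : VanishingMean f) : Tendsto f atTop (𝓝 0) := by
  rw [Metric.tendsto_atTop]
  intro η hη
  obtain ⟨δ, hδ, N, h⟩ := hf (η / 2) (by positivity)
  obtain ⟨N', hN'⟩ := Metric.tendsto_atTop.1 (hv.tendsto hδ.le) (δ * (η / 2)) (by positivity)
  refine ⟨max (max N N') 0, fun t ht => ?_⟩
  have ht0 : 0 ≤ t := (le_max_right _ _).trans ht
  have htN := ((le_max_left N N').trans (le_max_left _ 0)).trans ht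
  have htN' := ((le_max_right N N').trans (le_max_left _ 0)).trans ht
  -- By uniform continuity a large value at `t` persists, up to `η / 2`, on a whole window of length
  -- `δ`.
  have h1 : ∫ τ in t..t + δ, (‖f t‖ - η / 2) ≤ ∫ τ in t..t + δ, ‖f τ‖ := by
    refine intervalIntegral.integral_mono_on (by linarith) (by simp)
      (hv.intervalIntegrable ht0 (by linarith)).norm fun τ hτ => ?_
    have h2 := h t htN (τ - t) (by linarith [hτ.1]) (by linarith [hτ.2])
    rw [add_sub_cancel] at h2
    have h3 := norm_sub_norm_le (f t) (f τ)
    rw [norm_sub_rev] at h3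
    linarith
  have h4 := hN' t htN'
  rw [Real.dist_eq, sub_zero] at h4
  have h5 := (abs_lt.1 h4).2
  simp only [intervalIntegral.integral_const, add_sub_cancel_left, smul_eq_mul] at h1
  rw [dist_zero_right]
  have h6 : δ * (‖f t‖ - η / 2) < δ * (η / 2) := lt_of_le_of_lt h1 h5
  have := lt_of_mul_lt_mul_left h6 hδ.le
  linarith

end UniformlyContinuousAtInfinity

theorem VanishingMean.tendsto_increment {f F : ℝ → V} (hF : VanishingMean F)
    (hf : ∀ s t, 0 ≤ s → s ≤ t → f t - f s = ∫ τ in s..t, F τ) {h : ℝ} (hh : 0 ≤ h) :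
    Tendsto (fun t => f (t + h) - f t) atTop (𝓝 0) := by
  refine squeeze_zero_norm' ?_ (hF.tendsto hh)
  filter_upwards [eventually_ge_atTop 0] with t ht
  rw [hf t (t + h) ht (by linarith)]
  exact intervalIntegral.norm_integral_le_integral_norm (by linarith)

/-- If the second differences of a uniformly bounded sequence of functions vanish at infinity, so
do the first differences. -/
theorem tendsto_sub_zero_of_second_difference {c : ℕ → ℝ → V} {B : ℝ}
    (hB : ∀ k t, 0 ≤ t → ‖c k t‖ ≤ B)
    (hc : ∀ k, Tendsto (fun t => c (k + 2) t - (2 : ℝ) • c (k + 1) t + c k t) atTop (𝓝 0)) :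
    Tendsto (fun t => c 1 t - c 0 t) atTop (𝓝 0) := by
  -- All first differences agree asymptotically, so `c k` grows linearly in `k` with slope `c 1 - c
  -- 0`.
  have hstep : ∀ k, Tendsto (fun t => (c (k + 1) t - c k t) - (c 1 t - c 0 t)) atTop (𝓝 0) := by
    intro k
    induction k with
    | zero => simp
    | succ k ih =>
      have := ih.add (hc k)
      rw [add_zero] at this
      refine this.congr fun t => ?_
      module
  have hlin : ∀ k : ℕ,
      Tendsto (fun t => c k t - c 0 t - (k : ℝ) • (c 1 t - c 0 t)) atTop (𝓝 0) := by
    intro k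
    induction k with
    | zero => simp
    | succ k ih =>
      have := ih.add (hstep k)
      rw [add_zero] at this
      refine this.congr fun t => ?_
      push_cast
      module
  have hB0 : 0 ≤ B := (norm_nonneg _).trans (hB 0 0 le_rfl)
  rw [Metric.tendsto_atTop]
  intro η hη
  -- A slope of size `η` would, after `K` steps, exceed the room `2 * B` left by boundedness plus
  -- the error `1`.
  obtain ⟨K, hK⟩ := exists_nat_gt ((2 * B + 1) / η)
  rw [div_lt_iff₀ hη] at hK
  obtain ⟨N, hN⟩ := Metric.tendsto_atTop.1 (hlin K) 1 one_pos
  refine ⟨max N 0, fun t ht => ?_⟩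
  have ht0 : 0 ≤ t := (le_max_right _ _).trans ht
  have h1 := hN t ((le_max_left _ _).trans ht)
  rw [dist_zero_right] at h1 ⊢
  have h2 : ‖(K : ℝ) • (c 1 t - c 0 t)‖ ≤ 2 * B + 1 := by
    calc ‖(K : ℝ) • (c 1 t - c 0 t)‖
        = ‖(c K t - c 0 t) - (c K t - c 0 t - (K : ℝ) • (c 1 t - c 0 t))‖ := by
          congr 1; abel
      _ ≤ ‖c K t - c 0 t‖ + ‖c K t - c 0 t - (K : ℝ) • (c 1 t - c 0 t)‖ := norm_sub_le _ _
      _ ≤ (‖c K t‖ + ‖c 0 t‖) + 1 := by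
          gcongr
          exact norm_sub_le _ _
      _ ≤ 2 * B + 1 := by linarith [hB K t ht0, hB 0 t ht0]
  rw [norm_smul, Real.norm_natCast] at h2
  by_contra! hcon
  have : (K : ℝ) * η ≤ K * ‖c 1 t - c 0 t‖ := by gcongr
  linarith

end Vanishing

/-! ### Dissipation of energy in a network with delayed links -/

section Network

variable {ι : Type*} [Fintype ι] {V : Type*} [NormedAddCommGroup V] [InnerProductSpace ℝ V]

/-- A trajectory of a network of agents with states `(q i, ξ i)`, driven by `u` through the gains
`δ i`, in terms of the deviations `d i j`, `g i j` of the link signals from the states. The link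
relations say that the incoming wave at one end equals the delayed outgoing wave of the other. -/
structure IsNetworkTrajectory (G : SimpleGraph ι) [DecidableRel G.Adj] (a b : ι → ι → ℝ)
    (σ T : ℝ) (δ : ι → ℝ) (q ξ : ι → ℝ → V) (d g : ι → ι → ℝ → V) (u : ℝ → V) : Prop where
  continuousOn_q : ∀ i, ContinuousOn (q i) (Ici 0)
  continuousOn_ξ : ∀ i, ContinuousOn (ξ i) (Ici 0)
  continuousOn_u : ContinuousOn u (Ici 0)
  piecewiseContinuous_d : ∀ i j, G.Adj i j → PiecewiseContinuous T (d i j)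
  piecewiseContinuous_g : ∀ i j, G.Adj i j → PiecewiseContinuous T (g i j)
  hasDeriv_q : ∀ i t, 0 ≤ t → HasDerivWithinAt (q i)
    (∑ j ∈ G.neighborFinset i, (a i j • d i j t - b i j • g i j t) + δ i • u t) (Ici t) t
  hasDeriv_ξ : ∀ i t, 0 ≤ t → HasDerivWithinAt (ξ i)
    (∑ j ∈ G.neighborFinset i, b i j • d i j t) (Ici t) t
  link_q : ∀ i j, G.Adj i j → ∀ t, 0 ≤ t →
    (a i j • d i j (t + T) - b i j • g i j (t + T)) + σ • (q i (t + T) + d i j (t + T)) =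
      σ • (q j t + d j i t) - (a j i • d j i t - b j i • g j i t)
  link_ξ : ∀ i j, G.Adj i j → ∀ t, 0 ≤ t →
    b i j • d i j (t + T) + σ • (ξ i (t + T) + g i j (t + T)) =
      σ • (ξ j t + g j i t) - b j i • d j i t

theorem sum_neighborFinset_comm {G : SimpleGraph ι} [DecidableRel G.Adj] {A : Type*}
    [AddCommMonoid A] (f : ι → ι → A) :
    ∑ i, ∑ j ∈ G.neighborFinset i, f j i = ∑ i, ∑ j ∈ G.neighborFinset i, f i j := by
  refine Finset.sum_comm' fun i j => ?_
  simp [G.adj_comm]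

/-- The energy that enters a lossless channel with delay is bounded below. -/
theorem integral_sub_le_of_delay {T : ℝ} (hT : 0 < T) {P Q : ℝ → ℝ}
    (hP : PiecewiseContinuous T P) (hQ : PiecewiseContinuous T Q) (hP0 : ∀ t, 0 ≤ P t)
    (h : ∀ t, 0 ≤ t → P (t + T) = Q t) {t : ℝ} (ht : 0 ≤ t) :
    ∫ τ in (0 : ℝ)..t, (P τ - Q τ) ≤ ∫ τ in (0 : ℝ)..T, P τ := by
  have htT : 0 ≤ t + T := by linarith
  rw [intervalIntegral.integral_sub (hP.intervalIntegrable hT le_rfl ht)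
    (hQ.intervalIntegrable hT le_rfl ht)]
  -- The output is the shifted input, so the two integrals overlap on all but the initial delay
  -- interval and a final term of favourable sign.
  have h1 : ∫ τ in (0 : ℝ)..t, Q τ = ∫ τ in T..t + T, P τ := by
    have h2 := intervalIntegral.integral_comp_add_right (a := 0) (b := t) P T
    rw [zero_add] at h2
    rw [← h2]
    refine intervalIntegral.integral_congr fun τ hτ => ?_
    rw [uIcc_of_le ht] at hτ
    exact (h τ hτ.1).symm
  have h3 : ∫ τ in (0 : ℝ)..t, P τ ≤ ∫ τ in (0 : ℝ)..t + T, P τ :=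
    intervalIntegral.integral_mono_interval le_rfl ht (by linarith)
      (Eventually.of_forall hP0) (hP.intervalIntegrable hT le_rfl htT)
  have h4 := intervalIntegral.integral_add_adjacent_intervals
    (hP.intervalIntegrable hT le_rfl hT.le) (hP.intervalIntegrable hT hT.le htT)
  linarith

namespace IsNetworkTrajectory

variable {G : SimpleGraph ι} [DecidableRel G.Adj] {a b : ι → ι → ℝ} {σ T : ℝ} {δ : ι → ℝ}
  {q ξ : ι → ℝ → V} {d g : ι → ι → ℝ → V} {u : ℝ → V}

/-- The power that the links absorb. -/
theorem exists_power_bound (h : IsNetworkTrajectory G a b σ T δ q ξ d g u) (hσ : 0 < σ)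
    (hT : 0 < T) : ∃ K, ∀ t, 0 ≤ t → ∫ τ in (0 : ℝ)..t, (∑ i, ∑ j ∈ G.neighborFinset i,
      (inner ℝ (a i j • d i j τ - b i j • g i j τ) (q i τ + d i j τ) +
        inner ℝ (b i j • d i j τ) (ξ i τ + g i j τ))) ≤ K := by
  -- `P` is the total squared norm of the incoming waves and `Q` that of the outgoing ones, up to
  -- normalization.
  set P : ℝ → ℝ := fun τ => ∑ i, ∑ j ∈ G.neighborFinset i,
    (‖(a i j • d i j τ - b i j • g i j τ) + σ • (q i τ + d i j τ)‖ ^ 2 +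
      ‖b i j • d i j τ + σ • (ξ i τ + g i j τ)‖ ^ 2) with hPdef
  set Q : ℝ → ℝ := fun τ => ∑ i, ∑ j ∈ G.neighborFinset i,
    (‖σ • (q i τ + d i j τ) - (a i j • d i j τ - b i j • g i j τ)‖ ^ 2 +
      ‖σ • (ξ i τ + g i j τ) - b i j • d i j τ‖ ^ 2) with hQdef
  have hcq := fun i => PiecewiseContinuous.of_continuousOn hT (h.continuousOn_q i)
  have hcξ := fun i => PiecewiseContinuous.of_continuousOn hT (h.continuousOn_ξ i)
  have hsq : Continuous fun v : V => ‖v‖ ^ 2 := by fun_prop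
  have hP : PiecewiseContinuous T P := .sum fun i _ => .sum fun j hj => by
    have hij := (G.mem_neighborFinset i j).1 hj
    have hd := h.piecewiseContinuous_d i j hij
    have hg := h.piecewiseContinuous_g i j hij
    exact (((hd.const_smul _).sub (hg.const_smul _)).add
      (((hcq i).add hd).const_smul _) |>.map hsq).add
      ((hd.const_smul _).add (((hcξ i).add hg).const_smul _) |>.map hsq)
  have hQ : PiecewiseContinuous T Q := .sum fun i _ => .sum fun j hj => by
    have hij := (G.mem_neighborFinset i j).1 hj
    have hd := h.piecewiseContinuous_d i j hij
    have hg := h.piecewiseContinuous_g i j hij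
    exact ((((hcq i).add hd).const_smul _).sub
      ((hd.const_smul _).sub (hg.const_smul _)) |>.map hsq).add
      ((((hcξ i).add hg).const_smul _).sub (hd.const_smul _) |>.map hsq)
  have hdelay : ∀ t, 0 ≤ t → P (t + T) = Q t := by
    intro t ht
    simp only [hPdef, hQdef]
    -- Edges are reversed because the wave arriving at one end left the opposite end one delay
    -- earlier.
    rw [← sum_neighborFinset_comm]
    refine Finset.sum_congr rfl fun i _ => Finset.sum_congr rfl fun j hj => ?_
    have hji := ((G.mem_neighborFinset i j).1 hj).symm
    rw [h.link_q j i hji t ht, h.link_ξ j i hji t ht]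
  have hP0 : ∀ t, 0 ≤ P t := fun t =>
    Finset.sum_nonneg fun i _ => Finset.sum_nonneg fun j _ => by positivity
  refine ⟨(1 / (4 * σ)) * ∫ τ in (0 : ℝ)..T, P τ, fun t ht => ?_⟩
  have hb := integral_sub_le_of_delay hT hP hQ hP0 hdelay ht
  have heq : ∀ τ, (∑ i, ∑ j ∈ G.neighborFinset i,
      (inner ℝ (a i j • d i j τ - b i j • g i j τ) (q i τ + d i j τ) +
        inner ℝ (b i j • d i j τ) (ξ i τ + g i j τ))) = (1 / (4 * σ)) * (P τ - Q τ) := by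
    intro τ
    simp only [hPdef, hQdef, ← Finset.sum_sub_distrib, Finset.mul_sum]
    refine Finset.sum_congr rfl fun i _ => Finset.sum_congr rfl fun j _ => ?_
    -- Polarization turns power into a difference of squared wave norms.
    have hpol : ∀ v w : V, inner ℝ v w =
        (1 / (4 * σ)) * (‖v + σ • w‖ ^ 2 - ‖σ • w - v‖ ^ 2) := by
      intro v w
      rw [norm_add_sq_real, norm_sub_sq_real, real_inner_smul_right, real_inner_smul_left,
        real_inner_comm v w]
      field_simp
      ring
    rw [hpol, hpol (b i j • d i j τ)]
    ring
  simp only [heq, intervalIntegral.integral_const_mul]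
  gcongr

/-- The energy balance of a network whose input `u` comes from an input strictly passive system
with stored energy `s` and input `e`. -/
theorem exists_energy_bound (h : IsNetworkTrajectory G a b σ T δ q ξ d g u) (hσ : 0 < σ)
    (hT : 0 < T) {s s' : ℝ → ℝ} {e : ℝ → V} {m ε : ℝ} (hm : 0 < m)
    (hs : ContinuousOn s (Ici 0)) (he : ContinuousOn e (Ici 0))
    (hs' : ∀ t, 0 ≤ t → HasDerivWithinAt s (s' t) (Ici t) t)
    (hdiss : ∀ t, 0 ≤ t → s' t ≤ inner ℝ (e t) (u t) - ε * ‖e t‖ ^ 2)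
    (hsum : ∀ t, 0 ≤ t → ∑ i, δ i • q i t = -(m • e t)) :
    ∃ K, ∀ t, 0 ≤ t → (∑ i, (‖q i t‖ ^ 2 + ‖ξ i t‖ ^ 2)) / 2 + m * s t +
      ∫ τ in (0 : ℝ)..t, (∑ i, ∑ j ∈ G.neighborFinset i, a i j * ‖d i j τ‖ ^ 2 +
        m * ε * ‖e τ‖ ^ 2) ≤ K := by
  obtain ⟨K, hK⟩ := h.exists_power_bound hσ hT
  have hcq := fun i => PiecewiseContinuous.of_continuousOn hT (h.continuousOn_q i)
  have hcξ := fun i => PiecewiseContinuous.of_continuousOn hT (h.continuousOn_ξ i)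
  have hce := PiecewiseContinuous.of_continuousOn hT he
  set D : ℝ → ℝ := fun τ => ∑ i, ∑ j ∈ G.neighborFinset i, a i j * ‖d i j τ‖ ^ 2 +
    m * ε * ‖e τ‖ ^ 2 with hDdef
  set W : ℝ → ℝ := fun τ => ∑ i, ∑ j ∈ G.neighborFinset i,
      (inner ℝ (a i j • d i j τ - b i j • g i j τ) (q i τ + d i j τ) +
        inner ℝ (b i j • d i j τ) (ξ i τ + g i j τ)) with hWdef
  have hinner : Continuous fun y : V × V => inner ℝ y.1 y.2 := continuous_inner
  have hD : PiecewiseContinuous T D := by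
    refine PiecewiseContinuous.add (.sum fun i _ => .sum fun j hj => ?_)
      (hce.map (φ := fun v => m * ε * ‖v‖ ^ 2) (by fun_prop))
    have hd := h.piecewiseContinuous_d i j ((G.mem_neighborFinset i j).1 hj)
    exact hd.map (φ := fun v => a i j * ‖v‖ ^ 2) (by fun_prop)
  have hW : PiecewiseContinuous T W := .sum fun i _ => .sum fun j hj => by
    have hij := (G.mem_neighborFinset i j).1 hj
    have hd := h.piecewiseContinuous_d i j hij
    have hg := h.piecewiseContinuous_g i j hij
    exact (((hd.const_smul _).sub (hg.const_smul _)).map₂ ((hcq i).add hd) hinner).add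
      ((hd.const_smul _).map₂ ((hcξ i).add hg) hinner)
  set E : ℝ → ℝ := fun t => (∑ i, (‖q i t‖ ^ 2 + ‖ξ i t‖ ^ 2)) / 2 + m * s t with hEdef
  refine ⟨E 0 + K, fun t ht => ?_⟩
  have hEc : ContinuousOn E (Icc 0 t) := by
    have hsub : Icc 0 t ⊆ Ici (0 : ℝ) := Icc_subset_Ici_self
    refine ((continuousOn_finsetSum _ fun i _ => ?_).div_const 2).add
      ((hs.mono hsub).const_mul m)
    exact (((h.continuousOn_q i).mono hsub).norm.pow 2).add
      (((h.continuousOn_ξ i).mono hsub).norm.pow 2)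
  set E' : ℝ → ℝ := fun t => (∑ i,
    (2 * inner ℝ (q i t)
      (∑ j ∈ G.neighborFinset i, (a i j • d i j t - b i j • g i j t) + δ i • u t) +
     2 * inner ℝ (ξ i t) (∑ j ∈ G.neighborFinset i, b i j • d i j t))) / 2 + m * s' t with hE'def
  have hE' : ∀ τ, 0 ≤ τ → HasDerivWithinAt E (E' τ) (Ici τ) τ := fun τ hτ =>
    ((HasDerivWithinAt.fun_sum fun i _ =>
      (h.hasDeriv_q i τ hτ).norm_sq.add (h.hasDeriv_ξ i τ hτ).norm_sq).div_const 2).add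
      ((hs' τ hτ).const_mul m)
  have hbound : ∀ τ, 0 ≤ τ → E' τ ≤ W τ - D τ := by
    intro τ hτ
    -- This is the power injected by `u`; it cancels against the supply rate in `m * s'`.
    have h1 : ∑ i, inner ℝ (q i τ) (δ i • u τ) = -(m * inner ℝ (e τ) (u τ)) := by
      have h2 : ∀ i, inner ℝ (q i τ) (δ i • u τ) = inner ℝ (δ i • q i τ) (u τ) := fun i => by
        rw [real_inner_smul_left, real_inner_smul_right]
      simp only [h2]
      rw [← sum_inner, hsum τ hτ, inner_neg_left, real_inner_smul_left]
    have h3 : E' τ = ∑ i, ∑ j ∈ G.neighborFinset i,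
        (inner ℝ (q i τ) (a i j • d i j τ - b i j • g i j τ) +
          inner ℝ (ξ i τ) (b i j • d i j τ)) - m * inner ℝ (e τ) (u τ) + m * s' τ := by
      rw [sub_eq_add_neg, ← h1, ← Finset.sum_add_distrib]
      simp only [hE'def]
      rw [Finset.sum_div]
      congr 1
      refine Finset.sum_congr rfl fun i _ => ?_
      rw [inner_add_right, inner_sum, inner_sum, Finset.sum_add_distrib]
      ring
    -- The `b`-terms pairing `d` with `g` cancel by skew-symmetry, so `a‖d‖ ^ 2` is all that the
    -- links' power exceeds the agents' by.
    have h4 : W τ - D τ = ∑ i, ∑ j ∈ G.neighborFinset i,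
        (inner ℝ (q i τ) (a i j • d i j τ - b i j • g i j τ) +
          inner ℝ (ξ i τ) (b i j • d i j τ)) - m * ε * ‖e τ‖ ^ 2 := by
      simp only [hWdef, hDdef]
      rw [← sub_sub, ← Finset.sum_sub_distrib]
      congr 1
      refine Finset.sum_congr rfl fun i _ => ?_
      rw [← Finset.sum_sub_distrib]
      refine Finset.sum_congr rfl fun j _ => ?_
      simp only [inner_add_right, inner_sub_left, inner_sub_right, real_inner_smul_left,
        real_inner_smul_right, real_inner_self_eq_norm_sq]
      rw [real_inner_comm (q i τ) (d i j τ), real_inner_comm (q i τ) (g i j τ),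
        real_inner_comm (ξ i τ) (d i j τ), real_inner_comm (g i j τ) (d i j τ)]
      ring
    rw [h3, h4]
    have h5 := mul_le_mul_of_nonneg_left (hdiss τ hτ) hm.le
    linarith
  have hWD := hW.sub hD
  -- A comparison argument replaces integration of `E'`, because `s'` is not assumed integrable.
  have hmain := image_le_of_deriv_right_le_deriv_boundary hEc (fun τ hτ => hE' τ hτ.1)
    (B := fun t => E 0 + ∫ τ in (0 : ℝ)..t, (W τ - D τ)) (by simp)
    (continuousOn_const.add (hWD.continuousOn_integral hT ht))
    (fun τ hτ => (hWD.hasDerivWithinAt_integral hT hτ.1).const_add (E 0))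
    (fun τ hτ => hbound τ hτ.1) (right_mem_Icc.2 ht)
  rw [intervalIntegral.integral_sub (hW.intervalIntegrable hT le_rfl ht)
    (hD.intervalIntegrable hT le_rfl ht)] at hmain
  have hKt := hK t ht
  have hE : E t + ∫ τ in (0 : ℝ)..t, D τ ≤ E 0 + K := by linarith
  exact hE

end IsNetworkTrajectory

end Network

/-! ### Convergence of the network -/

namespace IsNetworkTrajectory

set_option linter.unusedSectionVars false

variable {ι : Type*} [Fintype ι] {V : Type*} [NormedAddCommGroup V] [InnerProductSpace ℝ V]
  {G : SimpleGraph ι} [DecidableRel G.Adj] {a b : ι → ι → ℝ} {σ T : ℝ} {δ : ι → ℝ}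
  {q ξ : ι → ℝ → V} {d g : ι → ι → ℝ → V} {u : ℝ → V}

/-- The link relations solved for the deviation at the sending end. -/
theorem exists_deviation_eq (h : IsNetworkTrajectory G a b σ T δ q ξ d g u) (hσ : 0 < σ)
    (ha : ∀ i j, a i j = a j i) (hb : ∀ i j, b i j = b j i) (i j : ι) :
    ∃ α β : ℝ, G.Adj i j → ∀ t, 0 ≤ t → (2 * b i j) • g i j t =
      (σ • (q j (t + T) - q i t) + b i j • (ξ j (t + T) - ξ i t)) +
        (α • d j i (t + T) + β • d i j t) := by
  -- With this multiplier, adding `c` times the `ξ`-relation to the `q`-relation eliminates `g j i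
  -- (t + T)`.
  obtain ⟨c, hc⟩ : ∃ c, b i j = c * σ := ⟨b i j / σ, by field_simp⟩
  refine ⟨a i j + σ + c * b i j, a i j - σ + c * b i j, fun hij t ht => ?_⟩
  have h1 := h.link_q j i hij.symm t ht
  have h2 := h.link_ξ j i hij.symm t ht
  rw [← ha i j, ← hb i j] at h1
  rw [← hb i j] at h2
  rw [hc] at h1 h2 ⊢
  linear_combination (norm := module) -h1 - c • h2

/-- The link relations solved for the deviation at the receiving end. -/
theorem exists_deviation_shift_eq (h : IsNetworkTrajectory G a b σ T δ q ξ d g u) (hσ : 0 < σ)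
    (ha : ∀ i j, a i j = a j i) (hb : ∀ i j, b i j = b j i) (i j : ι) :
    ∃ α β : ℝ, G.Adj i j → ∀ t, 0 ≤ t → (2 * b i j) • g j i (t + T) =
      (σ • (q j (t + T) - q i t) - b i j • (ξ j (t + T) - ξ i t)) +
        (α • d j i (t + T) + β • d i j t) := by
  -- Subtracting instead of adding eliminates `g i j t`.
  obtain ⟨c, hc⟩ : ∃ c, b i j = c * σ := ⟨b i j / σ, by field_simp⟩
  refine ⟨a i j + σ - c * b i j, a i j - σ - c * b i j, fun hij t ht => ?_⟩
  have h1 := h.link_q j i hij.symm t ht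
  have h2 := h.link_ξ j i hij.symm t ht
  rw [← ha i j, ← hb i j] at h1
  rw [← hb i j] at h2
  rw [hc] at h1 h2 ⊢
  linear_combination (norm := module) -h1 + c • h2

variable [CompleteSpace V]

theorem tendsto_ξ_increment (h : IsNetworkTrajectory G a b σ T δ q ξ d g u) (hT : 0 < T)
    (hd : ∀ i j, G.Adj i j → VanishingMean (d i j)) (i : ι) {l : ℝ} (hl : 0 ≤ l) :
    Tendsto (fun t => ξ i (t + l) - ξ i t) atTop (𝓝 0) := by
  have hvm : VanishingMean fun t => ∑ j ∈ G.neighborFinset i, b i j • d i j t :=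
    .sum fun j hj => (hd i j ((G.mem_neighborFinset i j).1 hj)).const_smul _
  refine hvm.tendsto_increment (fun s t hs hst => ?_) hl
  refine (PiecewiseContinuous.integral_eq_sub hT (h.continuousOn_ξ i) ?_ (h.hasDeriv_ξ i)
    hs hst).symm
  exact .sum fun j hj =>
    (h.piecewiseContinuous_d i j ((G.mem_neighborFinset i j).1 hj)).const_smul _

/-- No energy term controls `g`; substituting `exists_deviation_eq` trades it for states at times
`t` and `t + T`, which are bounded and continuous, and for deviations `d`, which go into `F`. -/
theorem exists_q_increment_eq (h : IsNetworkTrajectory G a b σ T δ q ξ d g u) (hσ : 0 < σ)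
    (hT : 0 < T) (ha : ∀ i j, a i j = a j i) (hb : ∀ i j, b i j = b j i)
    (hd : ∀ i j, G.Adj i j → VanishingMean (d i j)) (i : ι) :
    ∃ F, VanishingMean F ∧ ∀ s t, 0 ≤ s → s ≤ t → q i t - q i s = ∫ τ in s..t,
      ((δ i • u τ - ∑ j ∈ G.neighborFinset i, (1 / 2 : ℝ) •
        (σ • (q j (τ + T) - q i τ) + b i j • (ξ j (τ + T) - ξ i τ))) + F τ) := by
  choose α β hαβ using fun j => h.exists_deviation_eq hσ ha hb i j
  refine ⟨fun τ => ∑ j ∈ G.neighborFinset i, (a i j • d i j τ -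
    (1 / 2 : ℝ) • (α j • d j i (τ + T) + β j • d i j τ)), .sum fun j hj => ?_,
    fun s t hs hst => ?_⟩
  · have hij := (G.mem_neighborFinset i j).1 hj
    exact ((hd i j hij).const_smul _).sub
      (((((hd j i hij.symm).shift hT.le).const_smul _).add
        ((hd i j hij).const_smul _)).const_smul _)
  · rw [← PiecewiseContinuous.integral_eq_sub hT (h.continuousOn_q i) ?_ (h.hasDeriv_q i) hs hst]
    · refine intervalIntegral.integral_congr fun τ hτ => ?_
      rw [uIcc_of_le hst] at hτ
      have hsum : ∑ j ∈ G.neighborFinset i, b i j • g i j τ =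
          ∑ j ∈ G.neighborFinset i, ((1 / 2 : ℝ) •
            (σ • (q j (τ + T) - q i τ) + b i j • (ξ j (τ + T) - ξ i τ)) +
            (1 / 2 : ℝ) • (α j • d j i (τ + T) + β j • d i j τ)) := by
        refine Finset.sum_congr rfl fun j hj => ?_
        rw [← smul_add, ← hαβ j ((G.mem_neighborFinset i j).1 hj) τ (hs.trans hτ.1)]
        module
      simp only [Finset.sum_sub_distrib, hsum, Finset.sum_add_distrib]
      abel
    · refine PiecewiseContinuous.add (.sum fun j hj => ?_)
        ((PiecewiseContinuous.of_continuousOn hT h.continuousOn_u).const_smul _)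
      have hij := (G.mem_neighborFinset i j).1 hj
      exact ((h.piecewiseContinuous_d i j hij).const_smul _).sub
        ((h.piecewiseContinuous_g i j hij).const_smul _)

omit [CompleteSpace V] in
theorem continuousOn_shift {f : ℝ → V} (hf : ContinuousOn f (Ici 0)) {l : ℝ} (hl : 0 ≤ l) :
    ContinuousOn (fun t => f (t + l)) (Ici 0) :=
  hf.comp (by fun_prop) fun t (ht : 0 ≤ t) => (add_nonneg ht hl : 0 ≤ t + l)

omit [CompleteSpace V] in
theorem _root_.ContinuousOn.intervalIntegrable_of_nonneg {f : ℝ → V}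
    (hf : ContinuousOn f (Ici 0)) ⦃s t : ℝ⦄ (hs : 0 ≤ s) (ht : 0 ≤ t) :
    IntervalIntegrable f MeasureTheory.volume s t :=
  (hf.mono fun _ hτ => (le_min hs ht).trans hτ.1).intervalIntegrable

theorem uniformlyContinuousAtInfinity_q (h : IsNetworkTrajectory G a b σ T δ q ξ d g u)
    (hσ : 0 < σ) (hT : 0 < T) (ha : ∀ i j, a i j = a j i) (hb : ∀ i j, b i j = b j i)
    (hd : ∀ i j, G.Adj i j → VanishingMean (d i j)) {B : ℝ}
    (hq : ∀ i t, 0 ≤ t → ‖q i t‖ ≤ B) (hξ : ∀ i t, 0 ≤ t → ‖ξ i t‖ ≤ B)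
    (hu : ∀ t, 0 ≤ t → ‖u t‖ ≤ B) (i : ι) : UniformlyContinuousAtInfinity (q i) := by
  obtain ⟨F, hF, hint⟩ := h.exists_q_increment_eq hσ hT ha hb hd i
  refine .of_integral (B := |δ i| * B + ∑ j ∈ G.neighborFinset i,
    (1 / 2) * (σ * (B + B) + |b i j| * (B + B))) hF
    (ContinuousOn.intervalIntegrable_of_nonneg ?_) (fun t ht => ?_) hint
  · refine (h.continuousOn_u.const_smul _).sub (continuousOn_finsetSum _ fun j _ => ?_)
    exact ((((continuousOn_shift (h.continuousOn_q j) hT.le).sub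
      (h.continuousOn_q i)).const_smul _).add
      (((continuousOn_shift (h.continuousOn_ξ j) hT.le).sub
      (h.continuousOn_ξ i)).const_smul _)).const_smul _
  · have htT : 0 ≤ t + T := by linarith
    refine (norm_sub_le _ _).trans (add_le_add ?_ ((norm_sum_le _ _).trans
      (Finset.sum_le_sum fun j _ => ?_)))
    · rw [norm_smul, Real.norm_eq_abs]
      exact mul_le_mul_of_nonneg_left (hu t ht) (abs_nonneg _)
    · rw [norm_smul, Real.norm_of_nonneg (by norm_num : (0 : ℝ) ≤ 1 / 2)]
      refine mul_le_mul_of_nonneg_left ((norm_add_le _ _).trans (add_le_add ?_ ?_)) (by norm_num)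
      · rw [norm_smul, Real.norm_of_nonneg hσ.le]
        exact mul_le_mul_of_nonneg_left
          ((norm_sub_le _ _).trans (add_le_add (hq j _ htT) (hq i t ht))) hσ.le
      · rw [norm_smul, Real.norm_eq_abs]
        exact mul_le_mul_of_nonneg_left
          ((norm_sub_le _ _).trans (add_le_add (hξ j _ htT) (hξ i t ht))) (abs_nonneg _)

/-- The value `g j i (t + T)` is computed twice: as receiving end for the wave sent by `i` at `t`,
and as sending end for the wave reaching `i` at `t + 2T`. Equating the two cancels `ξ j` and leaves
an increment of `ξ i` and small terms; Barbalat's lemma upgrades the resulting vanishing mean to a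
limit. -/
theorem tendsto_second_difference (h : IsNetworkTrajectory G a b σ T δ q ξ d g u)
    (hσ : 0 < σ) (hT : 0 < T) (ha : ∀ i j, a i j = a j i) (hb : ∀ i j, b i j = b j i)
    (hd : ∀ i j, G.Adj i j → VanishingMean (d i j))
    (hq : ∀ i, UniformlyContinuousAtInfinity (q i)) {i j : ι} (hij : G.Adj i j) :
    Tendsto (fun t => q i (t + T + T) - (2 : ℝ) • q j (t + T) + q i t) atTop (𝓝 0) := by
  have hdji := (hd j i hij.symm).shift hT.le
  obtain ⟨α, β, h1⟩ := h.exists_deviation_shift_eq hσ ha hb i j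
  obtain ⟨α', β', h2⟩ := h.exists_deviation_eq hσ ha hb j i
  have hξ : VanishingMean fun t => (b i j / σ) • (ξ i (t + (T + T)) - ξ i t) := by
    refine VanishingMean.const_smul (.of_tendsto ?_
      (h.tendsto_ξ_increment hT hd i (by linarith))) _
    exact (continuousOn_shift (h.continuousOn_ξ i) (by linarith)).sub (h.continuousOn_ξ i)
  have hrest : VanishingMean fun t => (1 / σ) • ((α • d j i (t + T) + β • d i j t) -
      (α' • d i j (t + T + T) + β' • d j i (t + T))) :=
    (((hdji.const_smul _).add ((hd i j hij).const_smul _)).sub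
      (((((hd i j hij).shift hT.le).shift hT.le).const_smul _).add
        (hdji.const_smul _))).const_smul _
  refine UniformlyContinuousAtInfinity.tendsto_zero ?_ ((hrest.sub hξ).congr fun t ht => ?_)
  · exact ((((hq i).shift T).shift T).sub (((hq j).shift T).const_smul 2)).add (hq i)
  · have e1 := h1 hij t ht
    have e2 := h2 hij.symm (t + T) (by linarith)
    rw [hb j i] at e2
    refine smul_right_injective V hσ.ne' ?_
    simp only [smul_sub σ, smul_smul]
    rw [mul_one_div_cancel hσ.ne', mul_div_cancel₀ _ hσ.ne', ← add_assoc]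
    linear_combination (norm := module) e1 - e2

/-- The values `q i t`, `q j (t + T)`, `q i (t + 2T)`, … followed along a signal bouncing on the
link have vanishing second differences and are bounded. -/
theorem tendsto_neighbor (h : IsNetworkTrajectory G a b σ T δ q ξ d g u)
    (hσ : 0 < σ) (hT : 0 < T) (ha : ∀ i j, a i j = a j i) (hb : ∀ i j, b i j = b j i)
    (hd : ∀ i j, G.Adj i j → VanishingMean (d i j)) {B : ℝ}
    (hqB : ∀ i t, 0 ≤ t → ‖q i t‖ ≤ B)
    (hq : ∀ i, UniformlyContinuousAtInfinity (q i)) {i j : ι} (hij : G.Adj i j) :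
    Tendsto (fun t => q j (t + T) - q i t) atTop (𝓝 0) := by
  have key := tendsto_sub_zero_of_second_difference
    (c := fun k t => if Even k then q i (t + k * T) else q j (t + k * T)) (B := B) ?_ ?_
  · simpa using key
  · intro k t ht
    have : 0 ≤ t + k * T := by positivity
    split_ifs
    · exact hqB i _ this
    · exact hqB j _ this
  · intro k
    have hshift := tendsto_atTop_add_const_right atTop ((k : ℝ) * T) tendsto_id
    have e1 : ∀ t : ℝ, t + ((k + 1 : ℕ) : ℝ) * T = t + k * T + T := fun t => by push_cast; ring
    have e2 : ∀ t : ℝ, t + ((k + 2 : ℕ) : ℝ) * T = t + k * T + T + T := fun t => by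
      push_cast; ring
    have p1 : Even (k + 1) ↔ ¬ Even k := Nat.even_add_one
    have p2 : Even (k + 2) ↔ Even k := by simp [Nat.even_add]
    simp only [p1, p2, e1, e2]
    by_cases hk : Even k
    · simpa [hk, Function.comp_def] using
        (h.tendsto_second_difference hσ hT ha hb hd hq hij).comp hshift
    · simpa [hk, Function.comp_def] using
        (h.tendsto_second_difference hσ hT ha hb hd hq hij.symm).comp hshift

/-- Once the `σ`-terms are known to vanish, only `u` and the differences `ξ j - ξ i` drive `q i`.
The latter need not vanish, but they vary slowly, so their integral `I` over one delay is
asymptotically `T`-periodic. -/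
theorem exists_drift (h : IsNetworkTrajectory G a b σ T δ q ξ d g u)
    (hσ : 0 < σ) (hT : 0 < T) (ha : ∀ i j, a i j = a j i) (hb : ∀ i j, b i j = b j i)
    (hd : ∀ i j, G.Adj i j → VanishingMean (d i j))
    (hedge : ∀ i j, G.Adj i j → Tendsto (fun t => q j (t + T) - q i t) atTop (𝓝 0)) (i : ι) :
    ∃ I : ℝ → V, Tendsto (fun t => I (t + T) - I t) atTop (𝓝 0) ∧
      Tendsto (fun t => q i (t + T) - q i t - (δ i • ∫ τ in t..t + T, u τ) + I t)
        atTop (𝓝 0) := by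
  obtain ⟨F, hF, hint⟩ := h.exists_q_increment_eq hσ hT ha hb hd i
  set C : ℝ → V := fun τ => ∑ j ∈ G.neighborFinset i, (b i j / 2) • (ξ j τ - ξ i τ) with hC
  have hCc : ContinuousOn C (Ici 0) := continuousOn_finsetSum _ fun j _ =>
    ((h.continuousOn_ξ j).sub (h.continuousOn_ξ i)).const_smul _
  have hCT : VanishingMean fun t => C (t + T) - C t := by
    refine .of_tendsto ((continuousOn_shift hCc hT.le).sub hCc) ?_
    have : Tendsto (fun t => ∑ j ∈ G.neighborFinset i, (b i j / 2) •
        ((ξ j (t + T) - ξ j t) - (ξ i (t + T) - ξ i t))) atTop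
        (𝓝 (∑ j ∈ G.neighborFinset i, (b i j / 2) • ((0 : V) - 0))) :=
      tendsto_finsetSum _ fun j _ => ((h.tendsto_ξ_increment hT hd j hT.le).sub
        (h.tendsto_ξ_increment hT hd i hT.le)).const_smul _
    simp only [sub_zero, smul_zero, Finset.sum_const_zero] at this
    refine this.congr fun t => ?_
    rw [hC, ← Finset.sum_sub_distrib]
    exact Finset.sum_congr rfl fun j _ => by module
  set R : ℝ → V := fun τ => F τ - ∑ j ∈ G.neighborFinset i, (1 / 2 : ℝ) •
    (σ • (q j (τ + T) - q i τ) + b i j • (ξ j (τ + T) - ξ j τ)) with hR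
  have hRv : VanishingMean R := by
    refine hF.sub (.sum fun j hj => VanishingMean.const_smul (VanishingMean.add
      (VanishingMean.const_smul ?_ _) (VanishingMean.const_smul ?_ _)) _)
    · exact .of_tendsto ((continuousOn_shift (h.continuousOn_q j) hT.le).sub
        (h.continuousOn_q i)) (hedge i j ((G.mem_neighborFinset i j).1 hj))
    · exact .of_tendsto ((continuousOn_shift (h.continuousOn_ξ j) hT.le).sub
        (h.continuousOn_ξ j)) (h.tendsto_ξ_increment hT hd j hT.le)
  refine ⟨fun t => ∫ τ in t..t + T, C τ, ?_, ?_⟩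
  · refine squeeze_zero_norm' ?_ (hCT.tendsto hT.le)
    filter_upwards [eventually_ge_atTop 0] with t ht
    have htT : 0 ≤ t + T := by linarith
    rw [← intervalIntegral.integral_comp_add_right,
      ← intervalIntegral.integral_sub
        ((continuousOn_shift hCc hT.le).intervalIntegrable_of_nonneg ht htT)
        (hCc.intervalIntegrable_of_nonneg ht htT)]
    exact intervalIntegral.norm_integral_le_integral_norm (by linarith)
  · refine squeeze_zero_norm' ?_ (hRv.tendsto hT.le)
    filter_upwards [eventually_ge_atTop 0] with t ht
    have htT : 0 ≤ t + T := by linarith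
    have heq : q i (t + T) - q i t - (δ i • ∫ τ in t..t + T, u τ) + ∫ τ in t..t + T, C τ =
        ∫ τ in t..t + T, R τ := by
      have hu : IntervalIntegrable (fun τ => δ i • u τ) MeasureTheory.volume t (t + T) :=
        (h.continuousOn_u.const_smul (δ i)).intervalIntegrable_of_nonneg ht htT
      have hCi := hCc.intervalIntegrable_of_nonneg ht htT
      have hRi := hRv.intervalIntegrable ht htT
      have : q i (t + T) - q i t = ∫ τ in t..t + T, ((δ i • u τ - C τ) + R τ) := by
        rw [hint t (t + T) ht (by linarith)]
        refine intervalIntegral.integral_congr fun τ _ => ?_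
        have hsum : ∑ j ∈ G.neighborFinset i, (1 / 2 : ℝ) •
            (σ • (q j (τ + T) - q i τ) + b i j • (ξ j (τ + T) - ξ i τ)) =
            C τ + ∑ j ∈ G.neighborFinset i, (1 / 2 : ℝ) •
            (σ • (q j (τ + T) - q i τ) + b i j • (ξ j (τ + T) - ξ j τ)) := by
          rw [hC, ← Finset.sum_add_distrib]
          exact Finset.sum_congr rfl fun j _ => by module
        simp only [hsum, hR]
        abel
      rw [this, intervalIntegral.integral_add (hu.sub hCi) hRi,
        intervalIntegral.integral_sub hu hCi, intervalIntegral.integral_smul]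
      abel
    rw [heq]
    exact intervalIntegral.norm_integral_le_integral_norm (by linarith)

omit [CompleteSpace V] in
/-- If the second difference of a bounded function vanishes at infinity, so does the first. -/
theorem _root_.tendsto_shift_sub_of_drift {f J : ℝ → V} {T B : ℝ} (hT : 0 < T)
    (hB : ∀ t, 0 ≤ t → ‖f t‖ ≤ B) (hJ : Tendsto (fun t => J (t + T) - J t) atTop (𝓝 0))
    (hf : Tendsto (fun t => f (t + T) - f t + J t) atTop (𝓝 0)) :
    Tendsto (fun t => f (t + T) - f t) atTop (𝓝 0) := by
  have key := tendsto_sub_zero_of_second_difference (c := fun k t => f (t + k * T)) (B := B)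
    (fun k t ht => hB _ (by positivity)) fun k => ?_
  · simpa using key
  · have hshift : ∀ l : ℝ, Tendsto (fun t : ℝ => t + l) atTop atTop := fun l =>
      tendsto_atTop_add_const_right atTop l tendsto_id
    have := ((hf.comp (hshift (k * T + T))).sub (hf.comp (hshift (k * T)))).sub
      (hJ.comp (hshift (k * T)))
    simp only [sub_zero] at this
    refine this.congr fun t => ?_
    have e1 : t + ((k + 1 : ℕ) : ℝ) * T = t + k * T + T := by push_cast; ring
    have e2 : t + ((k + 2 : ℕ) : ℝ) * T = t + k * T + T + T := by push_cast; ring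
    simp only [Function.comp, e1, e2, ← add_assoc]
    module

/-- The shift by `T` in `tendsto_neighbor` is removed by showing asymptotic `T`-periodicity: of
every position if some agent is not driven by `u`, and otherwise of `q j - q i`, where `u` drops
out. -/
theorem tendsto_sub_of_adj (h : IsNetworkTrajectory G a b σ T δ q ξ d g u) (hG : G.Connected)
    (hσ : 0 < σ) (hT : 0 < T) (ha : ∀ i j, a i j = a j i) (hb : ∀ i j, b i j = b j i)
    (hδ : ∀ i, δ i = 0 ∨ δ i = 1) (hd : ∀ i j, G.Adj i j → VanishingMean (d i j)) {B : ℝ}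
    (hqB : ∀ i t, 0 ≤ t → ‖q i t‖ ≤ B)
    (hq : ∀ i, UniformlyContinuousAtInfinity (q i)) {i j : ι} (hij : G.Adj i j) :
    Tendsto (fun t => q j t - q i t) atTop (𝓝 0) := by
  have hedge : ∀ i j, G.Adj i j → Tendsto (fun t => q j (t + T) - q i t) atTop (𝓝 0) :=
    fun i j hij => h.tendsto_neighbor hσ hT ha hb hd hqB hq hij
  have hdrift := h.exists_drift hσ hT ha hb hd hedge
  by_cases hex : ∃ k, δ k = 0
  · obtain ⟨k, hk⟩ := hex
    have hper : ∀ l, Tendsto (fun t => q l (t + T) - q l t) atTop (𝓝 0) := by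
      intro l
      have hkl := (SimpleGraph.reachable_iff_reflTransGen k l).1 (hG.preconnected k l)
      induction hkl with
      | refl =>
        obtain ⟨I, hI, hkI⟩ := hdrift k
        refine tendsto_shift_sub_of_drift hT (hqB k) hI ?_
        simpa [hk] using hkI
      | @tail m l _ hml ih =>
        -- Both directions of the edge add up to the `T`-increments of `q l` and `q m`; the latter
        -- vanishes by induction.
        have := ((hedge m l hml).add (hedge l m hml.symm)).sub ih
        simp only [add_zero, sub_zero] at this
        exact this.congr fun t => by abel
    have := (hedge i j hij).sub (hper j)
    rw [sub_zero] at this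
    exact this.congr fun t => by abel
  · have hδ1 : ∀ k, δ k = 1 := fun k => (hδ k).resolve_left fun hk => hex ⟨k, hk⟩
    obtain ⟨I, hI, hiI⟩ := hdrift i
    obtain ⟨J, hJ, hjJ⟩ := hdrift j
    have hper : Tendsto (fun t => (q j (t + T) - q i (t + T)) - (q j t - q i t))
        atTop (𝓝 0) := by
      refine tendsto_shift_sub_of_drift (f := fun t => q j t - q i t) (J := fun t => J t - I t)
        (B := B + B) hT
        (fun t ht => (norm_sub_le _ _).trans (add_le_add (hqB j t ht) (hqB i t ht))) ?_ ?_
      · have := hJ.sub hI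
        rw [sub_zero] at this
        exact this.congr fun t => by abel
      · have := hjJ.sub hiI
        rw [sub_zero] at this
        refine this.congr fun t => ?_
        rw [hδ1, hδ1]
        abel
    -- The edge limits make `q j - q i` asymptotically `T`-antiperiodic; it is also `T`-periodic, so
    -- twice its value vanishes.
    have := (((hedge i j hij).sub (hedge j i hij.symm)).sub hper).const_smul (1 / 2 : ℝ)
    simp only [sub_zero, smul_zero] at this
    exact this.congr fun t => by module

/-- All agents converge to the origin if the weighted sum of their positions has vanishing
mean. -/
theorem tendsto_zero (h : IsNetworkTrajectory G a b σ T δ q ξ d g u) (hG : G.Connected)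
    (hσ : 0 < σ) (hT : 0 < T) (ha : ∀ i j, a i j = a j i) (hb : ∀ i j, b i j = b j i)
    (hδ : ∀ i, δ i = 0 ∨ δ i = 1) (hd : ∀ i j, G.Adj i j → VanishingMean (d i j)) {B : ℝ}
    (hqB : ∀ i t, 0 ≤ t → ‖q i t‖ ≤ B) (hξB : ∀ i t, 0 ≤ t → ‖ξ i t‖ ≤ B)
    (huB : ∀ t, 0 ≤ t → ‖u t‖ ≤ B) (hδsum : ∑ i, δ i ≠ 0)
    (hmean : VanishingMean fun t => ∑ i, δ i • q i t) (k : ι) :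
    Tendsto (q k) atTop (𝓝 0) := by
  have hq := h.uniformlyContinuousAtInfinity_q hσ hT ha hb hd hqB hξB huB
  have hsum : Tendsto (fun t => ∑ i, δ i • q i t) atTop (𝓝 0) :=
    UniformlyContinuousAtInfinity.tendsto_zero (.sum fun i _ => (hq i).const_smul _) hmean
  have hdiff : ∀ i, Tendsto (fun t => q i t - q k t) atTop (𝓝 0) := by
    intro i
    have hki := (SimpleGraph.reachable_iff_reflTransGen k i).1 (hG.preconnected k i)
    induction hki with
    | refl => simp
    | tail _ hml ih =>
      have := ih.add (h.tendsto_sub_of_adj hG hσ hT ha hb hδ hd hqB hq hml)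
      rw [add_zero] at this
      exact this.congr fun t => by abel
  have hall : Tendsto (fun t => ∑ i, δ i • (q i t - q k t)) atTop (𝓝 (∑ i, δ i • (0 : V))) :=
    tendsto_finsetSum _ fun i _ => (hdiff i).const_smul _
  simp only [smul_zero, Finset.sum_const_zero] at hall
  have := (hsum.sub hall).const_smul (∑ i, δ i)⁻¹
  rw [sub_zero, smul_zero] at this
  refine this.congr fun t => ?_
  simp only [smul_sub, Finset.sum_sub_distrib, sub_sub_cancel]
  rw [← Finset.sum_smul, smul_smul, inv_mul_cancel₀ hδsum, one_smul]

end IsNetworkTrajectory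

/-! ### A priori bounds from the energy balance -/

namespace IsNetworkTrajectory

variable {ι : Type*} [Fintype ι] {V : Type*} [NormedAddCommGroup V] [InnerProductSpace ℝ V]
  {G : SimpleGraph ι} [DecidableRel G.Adj] {a b : ι → ι → ℝ} {σ T : ℝ} {δ : ι → ℝ}
  {q ξ : ι → ℝ → V} {d g : ι → ι → ℝ → V} {u : ℝ → V}

/-- Boundedness and vanishing of the dissipated quantities, from the energy balance. -/
theorem exists_bounds (h : IsNetworkTrajectory G a b σ T δ q ξ d g u) (hσ : 0 < σ)
    (hT : 0 < T) (ha : ∀ i j, G.Adj i j → 0 < a i j) {s s' : ℝ → ℝ} {e : ℝ → V} {m ε : ℝ}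
    (hm : 0 < m) (hε : 0 < ε)
    (hs : ContinuousOn s (Ici 0)) (he : ContinuousOn e (Ici 0)) (hs0 : ∀ t, 0 ≤ s t)
    (hs' : ∀ t, 0 ≤ t → HasDerivWithinAt s (s' t) (Ici t) t)
    (hdiss : ∀ t, 0 ≤ t → s' t ≤ inner ℝ (e t) (u t) - ε * ‖e t‖ ^ 2)
    (hsum : ∀ t, 0 ≤ t → ∑ i, δ i • q i t = -(m • e t)) :
    (∃ B, ∀ t, 0 ≤ t → (∀ i, ‖q i t‖ ≤ B) ∧ (∀ i, ‖ξ i t‖ ≤ B) ∧ s t ≤ B) ∧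
      (∀ i j, G.Adj i j → VanishingMean (d i j)) ∧ VanishingMean e := by
  obtain ⟨K, hK⟩ := h.exists_energy_bound hσ hT hm hs he hs' hdiss hsum
  have hce := PiecewiseContinuous.of_continuousOn hT he
  have hpc : ∀ i j, G.Adj i j → PiecewiseContinuous T fun τ => a i j * ‖d i j τ‖ ^ 2 :=
    fun i j hij => (h.piecewiseContinuous_d i j hij).map
      (φ := fun v => a i j * ‖v‖ ^ 2) (by fun_prop)
  have hpe : PiecewiseContinuous T fun τ => m * ε * ‖e τ‖ ^ 2 :=
    hce.map (φ := fun v => m * ε * ‖v‖ ^ 2) (by fun_prop)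
  have hpd : PiecewiseContinuous T fun τ =>
      ∑ i, ∑ j ∈ G.neighborFinset i, a i j * ‖d i j τ‖ ^ 2 :=
    .sum fun i _ => .sum fun j hj => hpc i j ((G.mem_neighborFinset i j).1 hj)
  set D : ℝ → ℝ := fun τ => ∑ i, ∑ j ∈ G.neighborFinset i, a i j * ‖d i j τ‖ ^ 2 +
    m * ε * ‖e τ‖ ^ 2 with hDdef
  have hD : PiecewiseContinuous T D := hpd.add hpe
  have hterm : ∀ i τ, ∀ j ∈ G.neighborFinset i, 0 ≤ a i j * ‖d i j τ‖ ^ 2 := fun i τ j hj =>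
    mul_nonneg (ha i j ((G.mem_neighborFinset i j).1 hj)).le (sq_nonneg _)
  have hrow : ∀ i τ, 0 ≤ ∑ j ∈ G.neighborFinset i, a i j * ‖d i j τ‖ ^ 2 := fun i τ =>
    Finset.sum_nonneg (hterm i τ)
  have hed : ∀ τ, 0 ≤ m * ε * ‖e τ‖ ^ 2 := fun τ => by positivity
  have hD0 : ∀ τ, 0 ≤ D τ := fun τ =>
    add_nonneg (Finset.sum_nonneg fun i _ => hrow i τ) (hed τ)
  have hqξ : ∀ t, 0 ≤ (∑ i, (‖q i t‖ ^ 2 + ‖ξ i t‖ ^ 2)) / 2 := fun t => by positivity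
  have hint : ∀ t, 0 ≤ t → 0 ≤ ∫ τ in (0 : ℝ)..t, D τ := fun t ht =>
    intervalIntegral.integral_nonneg ht fun τ _ => hD0 τ
  have hDK : ∀ t, 0 ≤ t → ∫ τ in (0 : ℝ)..t, D τ ≤ K := fun t ht => by
    have h1 : _ + m * s t + ∫ τ in (0 : ℝ)..t, D τ ≤ K := hK t ht
    have := mul_nonneg hm.le (hs0 t)
    linarith [hqξ t]
  have hmeans : ∀ {F : ℝ → V} {c : ℝ}, 0 < c → PiecewiseContinuous T F →
      (∀ τ, c * ‖F τ‖ ^ 2 ≤ D τ) → VanishingMean F := by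
    intro F c hc hF hle
    refine .of_energy_le hT hF (K := K / c) fun t ht => ?_
    rw [le_div_iff₀ hc, mul_comm, ← intervalIntegral.integral_const_mul]
    refine le_trans ?_ (hDK t ht)
    refine intervalIntegral.integral_mono_on ht ?_ (hD.intervalIntegrable hT le_rfl ht)
      fun τ _ => hle τ
    exact (hF.map (φ := fun v => c * ‖v‖ ^ 2) (by fun_prop)).intervalIntegrable hT le_rfl ht
  -- `‖v‖ ^ 2 ≤ 2 * K` yields `2‖v‖ ≤ 2 * K + 1`; the stored energy is at most `K / m`.
  refine ⟨⟨2 * K + 1 + K / m, fun t ht => ?_⟩, fun i j hij => ?_, ?_⟩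
  · have h1 : (∑ i, (‖q i t‖ ^ 2 + ‖ξ i t‖ ^ 2)) / 2 + m * s t + ∫ τ in (0 : ℝ)..t, D τ ≤ K :=
      hK t ht
    have h2 := mul_nonneg hm.le (hs0 t)
    have h3 := hint t ht
    have h4 := hqξ t
    have hK0 : 0 ≤ K := by linarith
    have hKm : 0 ≤ K / m := by positivity
    have h5 : ∀ i, ‖q i t‖ ^ 2 + ‖ξ i t‖ ^ 2 ≤ 2 * K := fun i => by
      have := Finset.single_le_sum (f := fun i => ‖q i t‖ ^ 2 + ‖ξ i t‖ ^ 2)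
        (fun i _ => by positivity) (Finset.mem_univ i)
      linarith
    refine ⟨fun i => ?_, fun i => ?_, ?_⟩
    · nlinarith [h5 i, sq_nonneg ‖ξ i t‖, sq_nonneg (‖q i t‖ - 1)]
    · nlinarith [h5 i, sq_nonneg ‖q i t‖, sq_nonneg (‖ξ i t‖ - 1)]
    · have : s t ≤ K / m := by
        rw [le_div_iff₀ hm]
        linarith
      linarith
  · refine hmeans (ha i j hij) (h.piecewiseContinuous_d i j hij) fun τ => ?_
    have h1 := Finset.single_le_sum (hterm i τ) ((G.mem_neighborFinset i j).2 hij)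
    have h2 := Finset.single_le_sum (fun k _ => hrow k τ) (Finset.mem_univ i)
    exact (h1.trans h2).trans (le_add_of_nonneg_right (hed τ))
  · refine hmeans (mul_pos hm hε) hce fun τ => ?_
    exact le_add_of_nonneg_left (Finset.sum_nonneg fun i _ => hrow i τ)

end IsNetworkTrajectory

/-! ### The scattering relations -/

/-- The solution `r` of `exchanged a b q ξ r + σ • r = w`. -/
noncomputable def linkSignal (a b σ : ℝ) (w y : Stacked) : Stacked :=
  (1 / (σ * (a + σ) + b ^ 2)) •
    (σ • (w + couplingMap a b y).1 + b • (w + couplingMap a b y).2,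
      (a + σ) • (w + couplingMap a b y).2 - b • (w + couplingMap a b y).1)

theorem Continuous.linkSignal {w y : ℝ → Stacked} (hw : Continuous w) (hy : Continuous y)
    (a b σ : ℝ) : Continuous fun t => linkSignal a b σ (w t) (y t) := by
  unfold _root_.linkSignal couplingMap
  fun_prop

theorem Continuous.exchanged {q ξ : ℝ → Plane} {r : ℝ → Stacked} (hq : Continuous q)
    (hξ : Continuous ξ) (hr : Continuous r) (a b : ℝ) :
    Continuous fun t => exchanged a b (q t) (ξ t) (r t) := by
  unfold _root_.exchanged couplingMap
  fun_prop

/-- The block matrix `[a + σ, -b; b, σ]` has determinant `σ (a + σ) + b ^ 2 > 0`, so an incoming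
wave and the local state determine the link signal by Cramer's rule. -/
theorem eq_linkSignal {a b σ : ℝ} (ha : 0 < a) (hσ : 0 < σ) {q ξ : Plane} {r w : Stacked}
    (h : exchanged a b q ξ r + σ • r = w) : r = linkSignal a b σ w (q, ξ) := by
  have hΔ : σ * (a + σ) + b ^ 2 ≠ 0 := by positivity
  subst h
  refine smul_right_injective Stacked hΔ ?_
  simp only [linkSignal, smul_smul, mul_one_div_cancel hΔ, one_smul]
  refine Prod.ext ?_ ?_ <;>
  · simp only [exchanged, couplingMap, Prod.fst_add, Prod.snd_add, Prod.smul_fst, Prod.smul_snd,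
      Prod.fst_sub, Prod.snd_sub]
    module

namespace IsFeedbackSolution

variable {n : ℕ} {G : SimpleGraph (Fin n)} [DecidableRel G.Adj] {a b : Fin n → Fin n → ℝ}
  {Vh : Finset (Fin n)} {σ T : ℝ} {qr : Plane} {E : Type*} [NormedAddCommGroup E]
  [NormedSpace ℝ E] {Φ : HumanProcess E} {q ξ : Fin n → ℝ → Plane}
  {r : Fin n → Fin n → ℝ → Stacked} {x : ℝ → E} {uh : ℝ → Plane}

theorem link_eq (h : IsFeedbackSolution G a b Vh σ T qr Φ q ξ r x uh) (hσ : 0 < σ)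
    (hT : 0 < T) {i j : Fin n} (hij : G.Adj i j) {t : ℝ} (ht : 0 ≤ t) :
    exchanged (a i j) (b i j) (q i (t + T)) (ξ i (t + T)) (r i j (t + T)) + σ • r i j (t + T) =
      σ • r j i t - exchanged (a j i) (b j i) (q j t) (ξ j t) (r j i t) := by
  have h1 := h.channel_minus i j hij (t + T) (by linarith)
  simp only [delayed, add_sub_cancel_right, if_pos ht, sMinusFirst, sMinusSecond] at h1
  have hc : 1 / Real.sqrt (2 * σ) ≠ 0 := by positivity
  have h2 := smul_right_injective Stacked hc h1
  rw [← neg_inj, neg_add', h2, neg_sub]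

theorem link_eq_of_lt (h : IsFeedbackSolution G a b Vh σ T qr Φ q ξ r x uh) (hσ : 0 < σ)
    {i j : Fin n} (hij : G.Adj i j) {t : ℝ} (ht : 0 ≤ t) (htT : t < T) :
    exchanged (a i j) (b i j) (q i t) (ξ i t) (r i j t) + σ • r i j t = 0 := by
  have h1 := h.channel_minus i j hij t ht
  simp only [delayed, if_neg (not_le.2 (sub_neg.2 htT)), sMinusFirst] at h1
  have hc : 1 / Real.sqrt (2 * σ) ≠ 0 := by positivity
  have h2 := (smul_eq_zero.1 h1).resolve_left hc
  rw [← neg_eq_zero, neg_add', h2]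

/-- The link signals are continuous between the multiples of the delay. -/
theorem piecewiseContinuous_r (h : IsFeedbackSolution G a b Vh σ T qr Φ q ξ r x uh)
    (hσ : 0 < σ) (hT : 0 < T) (ha : ∀ i j, G.Adj i j → 0 < a i j) {i j : Fin n}
    (hij : G.Adj i j) : PiecewiseContinuous T (r i j) := by
  have hq : ∀ i, Continuous fun t => q i (max t 0) := fun i =>
    (h.continuous_q i).comp_continuous (by fun_prop) fun t => le_max_right t 0
  have hξ : ∀ i, Continuous fun t => ξ i (max t 0) := fun i =>
    (h.continuous_ξ i).comp_continuous (by fun_prop) fun t => le_max_right t 0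
  intro k
  -- Method of steps: on each delay interval the incoming wave is zero or is known from the previous
  -- interval at the reversed edge, hence the generalization.
  induction k generalizing i j with
  | zero =>
    refine ⟨fun t => linkSignal (a i j) (b i j) σ 0 (q i (max t 0), ξ i (max t 0)),
      continuous_const.linkSignal ((hq i).prodMk (hξ i)) _ _ _, fun t ht => ?_⟩
    simp only [Nat.cast_zero, zero_mul, zero_add, one_mul] at ht
    have := eq_linkSignal (ha i j hij) hσ (h.link_eq_of_lt hσ hij ht.1 ht.2)
    simpa only [max_eq_left ht.1] using this
  | succ k ih =>
    obtain ⟨R, hR, hRr⟩ := ih hij.symm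
    refine ⟨fun t => linkSignal (a i j) (b i j) σ
      (σ • R (t - T) - exchanged (a j i) (b j i) (q j (max (t - T) 0)) (ξ j (max (t - T) 0))
        (R (t - T))) (q i (max t 0), ξ i (max t 0)), ?_, fun t ht => ?_⟩
    · have hsub : Continuous fun t : ℝ => t - T := by fun_prop
      have hR' := hR.comp hsub
      exact ((hR'.const_smul σ).sub (((hq j).comp hsub).exchanged ((hξ j).comp hsub) hR'
        (a j i) (b j i))).linkSignal ((hq i).prodMk (hξ i)) _ _ _
    · push_cast at ht
      have hk : 0 ≤ (k : ℝ) * T := by positivity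
      have ht1 : (k : ℝ) * T ≤ t - T := by linarith [ht.1]
      have ht2 : t - T < ((k : ℝ) + 1) * T := by linarith [ht.2]
      have h0 : 0 ≤ t - T := hk.trans ht1
      have h0' : 0 ≤ t := by linarith
      have hlink := h.link_eq hσ hT hij h0
      rw [sub_add_cancel] at hlink
      have := eq_linkSignal (ha i j hij) hσ hlink
      simpa only [max_eq_left h0', max_eq_left h0, hRr ⟨ht1, ht2⟩] using this

theorem continuousOn_x (h : IsFeedbackSolution G a b Vh σ T qr Φ q ξ r x uh) :
    ContinuousOn x (Ici 0) := fun t ht => (h.human_state t ht).continuousWithinAt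

theorem continuousOn_error (h : IsFeedbackSolution G a b Vh σ T qr Φ q ξ r x uh) :
    ContinuousOn (fun t => qr - averagePosition Vh q t) (Ici 0) :=
  continuousOn_const.sub
    ((continuousOn_finsetSum Vh fun i _ => h.continuous_q i).const_smul (1 / (Vh.card : ℝ)) :)

theorem continuousOn_uh (h : IsFeedbackSolution G a b Vh σ T qr Φ q ξ r x uh) :
    ContinuousOn uh (Ici 0) :=
  (Φ.continuous_h.comp_continuousOn (h.continuousOn_x.prodMk h.continuousOn_error)).congr
    fun t ht => h.human_output t ht

/-- In the coordinates relative to the reference, a solution of the feedback system is a network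
trajectory. -/
theorem isNetworkTrajectory (h : IsFeedbackSolution G a b Vh σ T qr Φ q ξ r x uh)
    (hσ : 0 < σ) (hT : 0 < T) (ha : ∀ i j, G.Adj i j → 0 < a i j) :
    IsNetworkTrajectory G a b σ T (accessIndicator Vh) (fun i t => q i t - qr) ξ
      (fun i j t => (r i j t).1 - q i t) (fun i j t => (r i j t).2 - ξ i t) uh where
  continuousOn_q i := (h.continuous_q i).sub continuousOn_const
  continuousOn_ξ := h.continuous_ξ
  continuousOn_u := h.continuousOn_uh
  piecewiseContinuous_d i j hij := ((h.piecewiseContinuous_r hσ hT ha hij).map continuous_fst).sub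
    (.of_continuousOn hT (h.continuous_q i))
  piecewiseContinuous_g i j hij := ((h.piecewiseContinuous_r hσ hT ha hij).map continuous_snd).sub
    (.of_continuousOn hT (h.continuous_ξ i))
  hasDeriv_q i t ht := by
    simpa only [sub_sub_sub_cancel_right, Finset.sum_sub_distrib] using h.robot i t ht
  hasDeriv_ξ i t ht := by
    simpa only [sub_sub_sub_cancel_right] using h.controller i t ht
  link_q i j hij t ht := by
    have h1 := congrArg Prod.fst (h.link_eq hσ hT hij ht)
    simp only [exchanged, couplingMap, Prod.fst_add, Prod.smul_fst, Prod.fst_sub,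
      Prod.snd_sub] at h1
    linear_combination (norm := module) h1
  link_ξ i j hij t ht := by
    have h1 := congrArg Prod.snd (h.link_eq hσ hT hij ht)
    simp only [exchanged, couplingMap, Prod.snd_add, Prod.smul_snd, Prod.fst_sub,
      Prod.snd_sub] at h1
    linear_combination (norm := module) h1

end IsFeedbackSolution

/-! ### Sums over the accessible robots and conclusion -/

theorem sum_accessIndicator_smul {n : ℕ} (Vh : Finset (Fin n)) {A : Type*} [AddCommGroup A]
    [Module ℝ A] (f : Fin n → A) : ∑ i, accessIndicator Vh i • f i = ∑ i ∈ Vh, f i := by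
  simp [accessIndicator, ite_smul, Finset.sum_ite_mem]

theorem sum_accessIndicator {n : ℕ} (Vh : Finset (Fin n)) :
    ∑ i, accessIndicator Vh i = Vh.card := by
  simp [accessIndicator]

theorem sum_accessIndicator_smul_sub {n : ℕ} {Vh : Finset (Fin n)} (hVh : Vh.Nonempty)
    (q : Fin n → ℝ → Plane) (qr : Plane) (t : ℝ) :
    ∑ i, accessIndicator Vh i • (q i t - qr) =
      -((Vh.card : ℝ) • (qr - averagePosition Vh q t)) := by
  have hm : (Vh.card : ℝ) ≠ 0 := by exact_mod_cast hVh.card_pos.ne'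
  rw [sum_accessIndicator_smul, Finset.sum_sub_distrib, averagePosition, smul_sub, smul_smul,
    mul_one_div_cancel hm, one_smul, neg_sub, Finset.sum_const, Nat.cast_smul_eq_nsmul]

theorem proposition1 {n : ℕ} (G : SimpleGraph (Fin n)) [DecidableRel G.Adj]
    (hG : G.Connected)
    (a b : Fin n → Fin n → ℝ)
    (ha_symm : ∀ i j, a i j = a j i) (hb_symm : ∀ i j, b i j = b j i)
    (ha_pos : ∀ i j, G.Adj i j → 0 < a i j) (hb_pos : ∀ i j, G.Adj i j → 0 < b i j)
    (ha_zero : ∀ i j, ¬ G.Adj i j → a i j = 0) (hb_zero : ∀ i j, ¬ G.Adj i j → b i j = 0)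
    (Vh : Finset (Fin n)) (hVh : Vh.Nonempty)
    (σ : ℝ) (hσ : 0 < σ) (T : ℝ) (hT : 0 < T) (qr : Plane)
    {E : Type*} [NormedAddCommGroup E] [NormedSpace ℝ E] (Φ : HumanProcess E)
    (S : E → ℝ) (ε : ℝ) (hΦ : Φ.IsInputStrictlyPassiveWith S ε)
    (hΦ_bdd : Φ.HasBoundedOutput S)
    (q ξ : Fin n → ℝ → Plane) (r : Fin n → Fin n → ℝ → Stacked)
    (x : ℝ → E) (uh : ℝ → Plane)
    (hsol : IsFeedbackSolution G a b Vh σ T qr Φ q ξ r x uh) :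
    ∀ i, Tendsto (fun t => ‖q i t - qr‖) atTop (𝓝 0) := by
  have hnet := hsol.isNetworkTrajectory hσ hT ha_pos
  have hm : (0 : ℝ) < Vh.card := by exact_mod_cast hVh.card_pos
  have hsum := sum_accessIndicator_smul_sub hVh q qr
  obtain ⟨⟨B, hB⟩, hd, he⟩ := hnet.exists_bounds hσ hT ha_pos
    (s := fun t => S (x t)) hm hΦ.eps_pos
    (hΦ.differentiable.continuous.comp_continuousOn hsol.continuousOn_x)
    hsol.continuousOn_error (fun t => hΦ.nonneg _)
    (fun t ht => (hΦ.differentiable _).hasFDerivAt.comp_hasDerivWithinAt t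
      ((hsol.human_state t ht).mono (Ici_subset_Ici.2 ht)))
    (fun t ht => by
      rw [hsol.human_output t ht]
      exact hΦ.dissipation _ _)
    (fun t _ => hsum t)
  have heB : ∀ t, 0 ≤ t → ‖qr - averagePosition Vh q t‖ ≤ B := by
    intro t ht
    -- The error is minus an average of relative positions, so it inherits their bound `B`; this
    -- same `B` also bounds the stored energy, as `HasBoundedOutput` requires.
    have h1 : (Vh.card : ℝ) * ‖qr - averagePosition Vh q t‖ ≤ Vh.card * B := by
      rw [← Real.norm_of_nonneg hm.le, ← norm_smul, ← norm_neg, ← hsum t,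
        sum_accessIndicator_smul, Real.norm_of_nonneg hm.le, ← nsmul_eq_mul]
      exact norm_sum_le_of_le _ (fun i _ => (hB t ht).1 i) |>.trans_eq (by simp)
    exact le_of_mul_le_mul_left h1 hm
  obtain ⟨C, hC⟩ := hΦ_bdd B
  have huC : ∀ t, 0 ≤ t → ‖uh t‖ ≤ max B C := fun t ht => by
    rw [hsol.human_output t ht]
    exact (hC _ _ (hB t ht).2.2 (heB t ht)).trans (le_max_right _ _)
  intro i
  have hlim := hnet.tendsto_zero hG hσ hT ha_symm hb_symm
    (fun i => by simp only [accessIndicator]; split_ifs <;> simp) hd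
    (fun i t ht => ((hB t ht).1 i).trans (le_max_left B C))
    (fun i t ht => ((hB t ht).2.1 i).trans (le_max_left B C)) huC
    (by rw [sum_accessIndicator]; exact hm.ne')
    ((he.const_smul (-(Vh.card : ℝ))).congr fun t _ => by rw [hsum t, neg_smul]) i
  simpa using hlim.norm
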